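/- **Setting.** Let $d=d_1+d_2$ with $d_1,d_2\in\mathbb N_0$, and let $E(d)=O(d)\ltimes\mathbb R^d$ be the Euclidean group, acting on $\mathbb R^d$; write $\mathrm{rot}(g)\in O(d)$ for the linear component of $g\in E(d)$. Let $\mathcal G$ be a nontrivial discrete subgroup of $E(d)$ (all orbits are discrete) contained in $O(d_1)\oplus E(d_2)=\{(x_1,x_2)\mapsto(Ax_1,a(x_2)) : A\in O(d_1),\,a\in E(d_2)\}$, whose image $\mathcal S=\pi(\mathcal G)$ under the projection $\pi(A\oplus a)=a$ is a space group, i.e. a discrete subgroup of $E(d_2)$ containing $d_2$ translations with linearly independent translation components. Let $x_0\in\mathbb R^d$ be such that $g\mapsto g\cdot x_0$ is injective on $\mathcal G$. Let $\mathcal T\subset\mathcal G$ be such that $\pi$ maps $\mathcal T$ bijectively onto the group of translations in $\mathcal S$, let $\mathcal T^N=\{t^N:t\in\mathcal T\}$, and let $M_0$ be the set of all integers $N\ge1$ for which $\mathcal T^N$ is a normal subgroup of $\mathcal G$. For each $N\in M_0$ fix a (finite) representation set $\mathcal C_N$ of $\mathcal G/\mathcal T^N$. A function $u$ on $\mathcal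 G$ is $\mathcal T^N$-periodic if $u(gt)=u(g)$ for all $g\in\mathcal G$, $t\in\mathcal T^N$, and periodic if this holds for some $N\in M_0$. Let $U_{\mathrm{per}}$ be the space of periodic $u:\mathcal G\to\mathbb R^d$, with the uniform norm. **Potential and energy.** Let $V:(\mathbb R^d)^{\mathcal G\setminus\{\mathrm{id}\}}\to\mathbb R$ satisfy: (i) $V(Ay)=V(y)$ for all $A\in O(d)$ and all $y$; (ii) for every $y$ the map $z\mapsto V(y+z)$ on $L^\infty(\mathcal G\setminus\{\mathrm{id}\},\mathbb R^d)$ is twice continuously Fréchet differentiable; (iii) $V$ has finite interaction range: there is a finite $\mathcal R_V\subset\mathcal G\setminus\{\mathrm{id}\}$ with $V(y)=V(\chi_{\mathcal R_V}y)$ for all $y$. Put $y_0=(g\cdot x_0-x_0)_{g\ne\mathrm{id}}$, and let $V'(y_0)$ be the Fréchet derivative at $z=0$ of $z\mapsto V(y_0+z)$ on $L^\infty(\mathcal G\setminus\{\mathrm{id}\},\mathbb R^d)$. The configurational energy $E:U_{\mathrm{per}}\to\mathbb R$ is $$E(w)=\frac1{|\mathcal C_N|}\sum_{g\in\mathcal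 C_N}V\Big(\big((gh)\cdot w(gh)-g\cdot w(g)\big)_{h\in\mathcal G\setminus\{\mathrm{id}\}}\Big)\qquad\text{if } w \text{ is } \mathcal T^N\text{-periodic},\ N\in M_0 .$$ The identity deformation corresponds to the constant function $\chi_{\mathcal G}x_0\in U_{\mathrm{per}}$. **Seminorms.** For finite $\mathcal R\subset\mathcal G$ equip $(\mathbb R^d)^{\mathcal R}$ with its Euclidean norm. Let $U_{\mathrm{iso}}(\mathcal R)$ be the space of all $u:\mathcal R\to\mathbb R^d$ for which there are $a\in\mathbb R^d$ and a skew symmetric $S\in\mathbb R^{d\times d}$ with $\mathrm{rot}(g)u(g)=a+S(g\cdot x_0-x_0)$ for all $g\in\mathcal R$, and let $U_{\mathrm{iso},0,0}(\mathcal R)$ be defined in the same way with $S$ restricted to $S=S_1\oplus0_{d_2,d_2}$, $S_1\in\mathbb R^{d_1\times d_1}$ skew symmetric. For $\mathcal T^N$-periodic $u\in U_{\mathrm{per}}$ set $$\|u\|_{\mathcal R}=\Big(\frac1{|\mathcal C_N|}\sum_{g\in\mathcal C_N}\big\|\pi_{U_{\mathrm{iso}}(\mathcal R)}\big(u(g\,\cdot)|_{\mathcal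 R}\big)\big\|^2\Big)^{1/2},$$ where $\pi_{U_{\mathrm{iso}}(\mathcal R)}$ is the orthogonal projection with kernel $U_{\mathrm{iso}}(\mathcal R)$, and define $\|u\|_{\mathcal R,0,0}$ in the same way with $U_{\mathrm{iso},0,0}(\mathcal R)$. Fix a finite set $\mathcal R\subset\mathcal G$ such that there are $\mathcal R',\mathcal R''\subset\mathcal G$ with $\mathcal R'\mathcal R''\subset\mathcal R$, where $\mathrm{id}\in\mathcal R'$, $\mathcal R'$ generates $\mathcal G$, $\mathcal R''$ is finite, $\mathrm{id}\in\mathcal R''$, and $\mathcal R''\cdot x_0$ has the same affine hull as $\mathcal G\cdot x_0$. Define in $[-\infty,\infty]$ $$\lambda_{\mathrm a}=\sup\{c\in\mathbb R:\ c\|u\|_{\mathcal R}^2\le E''(\chi_{\mathcal G}x_0)(u,u)\ \ \forall u\in U_{\mathrm{per}}\},\qquad \lambda_{\mathrm a,0,0}=\sup\{c\in\mathbb R:\ c\|u\|_{\mathcal R,0,0}^2\le E''(\chi_{\mathcal G}x_0)(u,u)\ \ \forall u\in U_{\mathrm{per}}\}.$$ **Theorem.** Suppose that the onsite potential is in equilibrium,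 $V'(y_0)=0$. Then $E$ is twice continuously Fréchet differentiable on $U_{\mathrm{per}}$, and $E''(\chi_{\mathcal G}x_0)$ is bounded with respect to $\|\cdot\|_{\mathcal R}$: there is a constant $K>0$ with $$|E''(\chi_{\mathcal G}x_0)(u,v)|\le K\,\|u\|_{\mathcal R}\,\|v\|_{\mathcal R}\qquad\text{for all }u,v\in U_{\mathrm{per}}.$$ In particular $\lambda_{\mathrm a}\in\mathbb R$ and $\lambda_{\mathrm a,0,0}\in\mathbb R$. -/

import Mathlib

open scoped ENNReal Matrix

noncomputable section

namespace ObjStr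

/-- `ℝⁿ` with the Euclidean norm, coordinates indexed by `ι`. -/
abbrev Vec (ι : Type) [Fintype ι] := EuclideanSpace ℝ ι

/-- The orthogonal group (linear isometries of `ℝⁿ`). -/
abbrev Ort (ι : Type) [Fintype ι] := Vec ι ≃ₗᵢ[ℝ] Vec ι

/-- The Euclidean group (isometries of `ℝⁿ`), with composition as product. -/
abbrev Euc (ι : Type) [Fintype ι] := Vec ι ≃ᵃⁱ[ℝ] Vec ι

/-- The linear component of a Euclidean isometry. -/
def rot {ι : Type} [Fintype ι] (g : Euc ι) : Ort ι := g.linearIsometryEquiv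

/-- The translation component of a Euclidean isometry. -/
def trans {ι : Type} [Fintype ι] (g : Euc ι) : Vec ι := g 0

/-- A Euclidean isometry is a translation if its linear component is the identity. -/
def IsTranslation {ι : Type} [Fintype ι] (g : Euc ι) : Prop := rot g = 1

/-- A subgroup of the Euclidean group is discrete if all its orbits are discrete. -/
def IsDiscreteGroup {ι : Type} [Fintype ι] (Γ : Subgroup (Euc ι)) : Prop :=
  ∀ x : Vec ι, DiscreteTopology (Set.range fun g : Γ => (g : Euc ι) x)

/-- A `d`-dimensional space group: a discrete subgroup of the Euclidean group that contains `d`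
translations whose translation components are linearly independent. -/
def IsSpaceGroup {d : ℕ} (Γ : Subgroup (Euc (Fin d))) : Prop :=
  IsDiscreteGroup Γ ∧
    ∃ s : Fin d → Euc (Fin d), (∀ i, s i ∈ Γ ∧ IsTranslation (s i)) ∧
      LinearIndependent ℝ fun i => trans (s i)

/-- The ambient space `ℝᵈ = ℝ^{d₁} × ℝ^{d₂}`, `d = d₁ + d₂`. -/
abbrev Amb (d₁ d₂ : ℕ) := Vec (Fin d₁ ⊕ Fin d₂)

section blocks

variable {d₁ d₂ : ℕ}

/-- First component of a vector in `ℝ^{d₁} × ℝ^{d₂}`. -/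
def fstPart (x : Amb d₁ d₂) : Vec (Fin d₁) := WithLp.toLp 2 fun i => x (Sum.inl i)

/-- Second component of a vector in `ℝ^{d₁} × ℝ^{d₂}`. -/
def sndPart (x : Amb d₁ d₂) : Vec (Fin d₂) := WithLp.toLp 2 fun i => x (Sum.inr i)

/-- The vector in `ℝ^{d₁} × ℝ^{d₂}` with given components. -/
def join (v : Vec (Fin d₁)) (w : Vec (Fin d₂)) : Amb d₁ d₂ :=
  WithLp.toLp 2 (Sum.elim (fun i => v i) fun i => w i)

@[simp] theorem fstPart_join (v : Vec (Fin d₁)) (w : Vec (Fin d₂)) : fstPart (join v w) = v := rfl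

@[simp] theorem sndPart_join (v : Vec (Fin d₁)) (w : Vec (Fin d₂)) : sndPart (join v w) = w := rfl

@[simp] theorem join_parts (x : Amb d₁ d₂) : join (fstPart x) (sndPart x) = x := by
  ext i
  cases i <;> rfl

theorem norm_join_sq (v : Vec (Fin d₁)) (w : Vec (Fin d₂)) :
    ‖join v w‖ ^ 2 = ‖v‖ ^ 2 + ‖w‖ ^ 2 := by
  simp [EuclideanSpace.real_norm_sq_eq, join, Fintype.sum_sum_type]

/-- The block diagonal orthogonal map `A ⊕ B`. -/
def blockOrt (A : Ort (Fin d₁)) (B : Ort (Fin d₂)) : Ort (Fin d₁ ⊕ Fin d₂) where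
  toFun x := join (A (fstPart x)) (B (sndPart x))
  invFun x := join (A.symm (fstPart x)) (B.symm (sndPart x))
  left_inv x := by simp
  right_inv x := by simp
  map_add' x y := by
    have h1 : fstPart (x + y) = fstPart x + fstPart y := rfl
    have h2 : sndPart (x + y) = sndPart x + sndPart y := rfl
    rw [h1, h2, map_add, map_add]
    ext i
    cases i <;> rfl
  map_smul' c x := by
    have h1 : fstPart (c • x) = c • fstPart x := rfl
    have h2 : sndPart (c • x) = c • sndPart x := rfl
    rw [h1, h2, map_smul, map_smul]
    ext i
    cases i <;> rfl
  norm_map' x := by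
    have h : ‖join (A (fstPart x)) (B (sndPart x))‖ ^ 2 = ‖x‖ ^ 2 := by
      rw [norm_join_sq, A.norm_map, B.norm_map, ← norm_join_sq, join_parts]
    exact (sq_eq_sq₀ (norm_nonneg _) (norm_nonneg _)).1 h

/-- The group homomorphism `⊕ : O(d₁) × E(d₂) → E(d₁ + d₂)`, `(A₁, (A₂, b₂)) ↦ (A₁ ⊕ A₂, (0, b₂))`;
on vectors it acts as `(x₁, x₂) ↦ (A₁ x₁, A₂ x₂ + b₂)`. -/
def oplus : Ort (Fin d₁) × Euc (Fin d₂) →* Euc (Fin d₁ ⊕ Fin d₂) where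
  toFun p := AffineIsometryEquiv.mk' (fun x => join (p.1 (fstPart x)) (p.2 (sndPart x)))
    (blockOrt p.1 (rot p.2)) 0 (by
      intro x
      have h2 : p.2 (sndPart x) = rot p.2 (sndPart x) + p.2 0 := by
        have := p.2.map_vadd 0 (sndPart x)
        simpa [rot] using this
      have h1 : p.1 (fstPart (0 : Amb d₁ d₂)) = 0 := map_zero p.1
      have h0 : sndPart (0 : Amb d₁ d₂) = 0 := rfl
      rw [h1, h0, h2]
      ext i
      cases i <;> simp [join, blockOrt])
  map_one' := by
    ext x i
    simp
  map_mul' p q := by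
    ext x i
    simp

@[simp] theorem oplus_apply (p : Ort (Fin d₁) × Euc (Fin d₂)) (x : Amb d₁ d₂) :
    oplus p x = join (p.1 (fstPart x)) (p.2 (sndPart x)) := rfl

end blocks

/-- The set `Tᴺ = {tᴺ : t ∈ T}`. -/
def powSet {Γ : Type} [Group Γ] (T : Set Γ) (N : ℕ) : Set Γ := (fun t => t ^ N) '' T

/-- In a finite-by-abelian group some power map is a homomorphism that kills the finite part. -/
theorem exists_pow_hom {Γ : Type} [Group Γ] (F H : Subgroup Γ) [Finite F] [F.Normal] (hFH : F ≤ H)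
    (hc : ∀ x ∈ H, ∀ y ∈ H, x * y * x⁻¹ * y⁻¹ ∈ F) :
    ∃ K : ℕ, 0 < K ∧ (∀ f ∈ F, f ^ K = 1) ∧
      ∀ x ∈ H, ∀ y ∈ H, (x * y) ^ K = x ^ K * y ^ K ∧ Commute (x ^ K) y := by
  set m := Nat.card F
  set k := Nat.card (MulAut F)
  have hfin : Finite (MulAut F) :=
    Finite.of_injective (fun e : MulAut F => (e : F → F)) DFunLike.coe_injective
  have hm : ∀ f ∈ F, f ^ m = 1 := fun f hf => by
    have h : (⟨f, hf⟩ : F) ^ m = 1 := pow_card_eq_one'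
    exact congrArg Subtype.val h
  have h1 : ∀ x, ∀ f ∈ F, Commute (x ^ k) f := by
    intro x f hf
    have h : MulAut.conjNormal (H := F) (x ^ k) = 1 := by
      rw [map_pow]
      exact pow_card_eq_one'
    have h2 := congrArg Subtype.val (DFunLike.congr_fun h (⟨f, hf⟩ : F))
    rw [MulAut.conjNormal_apply] at h2
    exact (mul_inv_eq_iff_eq_mul.1 h2)
  have h2 : ∀ x ∈ H, ∀ y ∈ H, Commute (x ^ (k * m)) y := by
    intro x hx y hy
    have hcF : y * x ^ k * y⁻¹ * (x ^ k)⁻¹ ∈ F := hc y hy _ (H.pow_mem hx k)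
    have e : y * x ^ k * y⁻¹ = (y * x ^ k * y⁻¹ * (x ^ k)⁻¹) * x ^ k := by group
    have e2 : (y * x ^ k * y⁻¹) ^ m = (x ^ k) ^ m := by
      rw [e, ((h1 x _ hcF).symm).mul_pow, hm _ hcF, one_mul]
    rw [conj_pow, ← pow_mul] at e2
    exact (mul_inv_eq_iff_eq_mul.1 e2).symm
  refine ⟨k * m * m, Nat.mul_pos (Nat.mul_pos Nat.card_pos Nat.card_pos) Nat.card_pos, ?_, ?_⟩
  · intro f hf
    rw [mul_comm, pow_mul, hm f hf, one_pow]
  · intro x hx y hy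
    constructor
    · set f := (x * y) ^ (k * m) * (x ^ (k * m) * y ^ (k * m))⁻¹ with hf
      have hfF : f ∈ F := by
        rw [← QuotientGroup.eq_one_iff]
        have hq : Commute (x : Γ ⧸ F) (y : Γ ⧸ F) := by
          have := (QuotientGroup.eq_one_iff _).2 (hc x hx y hy)
          simp only [QuotientGroup.mk_mul, QuotientGroup.mk_inv] at this
          exact mul_inv_eq_iff_eq_mul.1 (mul_inv_eq_one.1 this)
        simp [hf, hq.mul_pow]
      have e : (x * y) ^ (k * m) = f * (x ^ (k * m) * y ^ (k * m)) :=
        (inv_mul_cancel_right _ _).symm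
      have c1 := h2 x hx f (hFH hfF)
      have c2 := h2 y hy f (hFH hfF)
      have c3 := h2 x hx _ (H.pow_mem hy (k * m))
      rw [pow_mul, e, ((c1.mul_left c2).symm).mul_pow, hm f hfF, one_mul, c3.mul_pow,
        ← pow_mul, ← pow_mul]
    · rw [pow_mul]
      exact (h2 x hx y hy).pow_left m

/-- An objective structure in normal form.  The discrete group `𝒢 < O(d₁) ⊕ 𝒮` is given as a
subgroup of `O(d₁) × E(d₂)`, embedded in `E(d₁ + d₂)` by the injective homomorphism `oplus`; the
projection `π` is the second projection and the space group `𝒮` is `π(𝒢)`. -/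
structure ObjectiveStructure (d₁ d₂ : ℕ) where
  /-- the group `𝒢` -/
  G : Subgroup (Ort (Fin d₁) × Euc (Fin d₂))
  discrete : IsDiscreteGroup (G.map oplus)
  spaceGroup : IsSpaceGroup (G.map (MonoidHom.snd _ _))
  /-- the reference point `x₀` -/
  x₀ : Amb d₁ d₂
  injective : Function.Injective fun g : G => oplus (g : Ort (Fin d₁) × Euc (Fin d₂)) x₀
  /-- a section `𝒯 ⊂ 𝒢` of the group of translations of `𝒮` -/
  T : Set G
  section_T : Set.BijOn (fun g : G => (g : Ort (Fin d₁) × Euc (Fin d₂)).2) T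
    {s | s ∈ G.map (MonoidHom.snd _ _) ∧ IsTranslation s}

namespace ObjectiveStructure

variable {d₁ d₂ : ℕ} (X : ObjectiveStructure d₁ d₂)

/-- The action `g · x` of `𝒢` on `ℝᵈ`. -/
def act (g : X.G) (x : Amb d₁ d₂) : Amb d₁ d₂ :=
  oplus (g : Ort (Fin d₁) × Euc (Fin d₂)) x

/-- The linear component of `g ∈ 𝒢`, an element of `O(d)`. -/
def lin (g : X.G) : Ort (Fin d₁ ⊕ Fin d₂) := rot (oplus (g : Ort (Fin d₁) × Euc (Fin d₂)))

/-- The set `M₀` of all positive `N` for which `𝒯ᴺ` is a normal subgroup of `𝒢`. -/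
def M₀ : Set ℕ :=
  {N | 0 < N ∧ ∃ H : Subgroup X.G, H.Normal ∧ (H : Set X.G) = powSet X.T N}

/-- `𝒯ᴺ`-periodicity of a function on `𝒢`. -/
def IsPeriodicWith {α : Type} (N : ℕ) (u : X.G → α) : Prop :=
  ∀ g, ∀ t ∈ powSet X.T N, u g = u (g * t)

/-- A choice of a representation set `C N` of `𝒢 / 𝒯ᴺ` for each `N ∈ M₀`. -/
def IsRepSystem (C : ℕ → Set X.G) : Prop :=
  ∀ N ∈ X.M₀, ∀ g, ∃! c, c ∈ C N ∧ c⁻¹ * g ∈ powSet X.T N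

/-! Helper facts: the periods are cofinal for divisibility, so that sums of periodic functions and
constant functions are periodic. -/

section periods

theorem act_mul (g h : X.G) (x : Amb d₁ d₂) : X.act (g * h) x = X.act g (X.act h x) := by
  simp [act]

theorem finite_kernel : Set.Finite {f : X.G | (f : Ort (Fin d₁) × Euc (Fin d₂)).2 = 1} := by
  have hO : ∀ g, X.act g X.x₀ ∈ Set.range fun g : X.G.map oplus => (g : Euc _) X.x₀ :=
    fun g => ⟨⟨oplus (g : Ort (Fin d₁) × Euc (Fin d₂)), g, g.2, rfl⟩, rfl⟩
  have hO2 : ∀ p ∈ Set.range fun g : X.G.map oplus => (g : Euc _) X.x₀,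
      ∃ g, p = X.act g X.x₀ := by
    rintro _ ⟨⟨_, g, hg, rfl⟩, rfl⟩
    exact ⟨⟨g, hg⟩, rfl⟩
  have hd := X.discrete X.x₀
  set O := Set.range fun g : X.G.map oplus => (g : Euc _) X.x₀ with hOdef
  have h1 : X.act 1 X.x₀ = X.x₀ := by simp [act]
  have hx : X.x₀ ∈ O := h1 ▸ hO 1
  obtain ⟨ε, hε, hball⟩ := Metric.exists_ball_inter_eq_singleton_of_mem_discrete
    (isDiscrete_iff_discreteTopology.2 hd) hx
  have hdist : ∀ (g : X.G) x y, dist (X.act g x) (X.act g y) = dist x y := fun g x y =>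
    (oplus (g : Ort (Fin d₁) × Euc (Fin d₂))).dist_map x y
  have hsep : O.Pairwise fun x y => ε ≤ dist x y := by
    intro p hp q hq hpq
    obtain ⟨g, rfl⟩ := hO2 p hp
    obtain ⟨h, rfl⟩ := hO2 q hq
    by_contra hlt
    push Not at hlt
    have e : dist (X.act g X.x₀) (X.act h X.x₀) = dist X.x₀ (X.act (g⁻¹ * h) X.x₀) := by
      rw [← hdist g X.x₀, ← act_mul, mul_inv_cancel_left]
    have hm : X.act (g⁻¹ * h) X.x₀ ∈ Metric.ball X.x₀ ε ∩ O :=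
      ⟨by rw [Metric.mem_ball, dist_comm, ← e]; exact hlt, hO _⟩
    rw [hball] at hm
    apply hpq
    have := congrArg (X.act g) (Set.mem_singleton_iff.1 hm)
    rw [← act_mul, mul_inv_cancel_left] at this
    exact this.symm
  have hfin : Set.Finite (Metric.closedBall 0 ‖X.x₀‖ ∩ O) :=
    Metric.finite_isBounded_inter_isClosed (isDiscrete_iff_discreteTopology.2 hd)
      Metric.isBounded_closedBall (Metric.isClosed_of_pairwise_le_dist hε hsep)
  refine Set.Finite.of_finite_image (hfin.subset ?_) (X.injective.injOn)
  rintro _ ⟨f, hf, rfl⟩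
  refine ⟨?_, hO f⟩
  rw [mem_closedBall_zero_iff]
  have h2 : ‖oplus (f : Ort (Fin d₁) × Euc (Fin d₂)) X.x₀‖ ^ 2 = ‖X.x₀‖ ^ 2 := by
    have hf' : (f : Ort (Fin d₁) × Euc (Fin d₂)).2 = 1 := hf
    rw [oplus_apply, norm_join_sq, hf', LinearIsometryEquiv.norm_map]
    conv_rhs => rw [← join_parts X.x₀, norm_join_sq]
    simp
  exact ((sq_eq_sq₀ (norm_nonneg _) (norm_nonneg _)).1 h2).le

/-- The subgroup `𝒯ℱ = π⁻¹(𝒯_𝒮)`. -/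
def TF : Subgroup X.G where
  carrier := {g | IsTranslation (g : Ort (Fin d₁) × Euc (Fin d₂)).2}
  one_mem' := rfl
  mul_mem' {a b} ha hb := by
    have e : rot ((a * b : X.G) : Ort (Fin d₁) × Euc (Fin d₂)).2 =
      rot (a : Ort (Fin d₁) × Euc (Fin d₂)).2 * rot (b : Ort (Fin d₁) × Euc (Fin d₂)).2 := rfl
    have ha' : rot (a : Ort (Fin d₁) × Euc (Fin d₂)).2 = 1 := ha
    have hb' : rot (b : Ort (Fin d₁) × Euc (Fin d₂)).2 = 1 := hb
    change rot _ = 1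
    rw [e, ha', hb', one_mul]
  inv_mem' {a} ha := by
    have e : rot ((a⁻¹ : X.G) : Ort (Fin d₁) × Euc (Fin d₂)).2 =
      (rot (a : Ort (Fin d₁) × Euc (Fin d₂)).2)⁻¹ := rfl
    have ha' : rot (a : Ort (Fin d₁) × Euc (Fin d₂)).2 = 1 := ha
    change rot _ = 1
    rw [e, ha', inv_one]

instance : X.TF.Normal where
  conj_mem a ha g := by
    have e : rot ((g * a * g⁻¹ : X.G) : Ort (Fin d₁) × Euc (Fin d₂)).2 =
      rot (g : Ort (Fin d₁) × Euc (Fin d₂)).2 * rot (a : Ort (Fin d₁) × Euc (Fin d₂)).2 *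
        (rot (g : Ort (Fin d₁) × Euc (Fin d₂)).2)⁻¹ := rfl
    have ha' : rot (a : Ort (Fin d₁) × Euc (Fin d₂)).2 = 1 := ha
    change rot _ = 1
    rw [e, ha', mul_one, mul_inv_cancel]

theorem translation_apply {ι : Type} [Fintype ι] {a : Euc ι} (ha : IsTranslation a) (x : Vec ι) :
    a x = x + a 0 := by
  have h := a.map_vadd 0 x
  have ha' : a.linearIsometryEquiv = 1 := ha
  simpa [ha'] using h

theorem translation_comm {ι : Type} [Fintype ι] {a b : Euc ι} (ha : IsTranslation a)
    (hb : IsTranslation b) : a * b = b * a := by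
  ext1 x
  rw [AffineIsometryEquiv.coe_mul, AffineIsometryEquiv.coe_mul, Function.comp, Function.comp,
    translation_apply ha, translation_apply hb, translation_apply hb (a x), translation_apply ha x]
  abel

theorem exists_period : ∃ K : ℕ, 0 < K ∧ ∀ k : ℕ, 0 < k → K * k ∈ X.M₀ := by
  set p : X.G →* Euc (Fin d₂) := (MonoidHom.snd _ _).comp X.G.subtype with hp
  have hfin : Finite p.ker := X.finite_kernel.to_subtype
  obtain ⟨K, hK, hF, hH⟩ := exists_pow_hom p.ker X.TF
    (by
      intro f hf
      have hf' : (f : Ort (Fin d₁) × Euc (Fin d₂)).2 = 1 := hf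
      change IsTranslation _
      rw [hf']
      rfl)
    (by
      intro x hx y hy
      rw [MonoidHom.mem_ker, map_mul, map_mul, map_mul, map_inv, map_inv]
      have := translation_comm (a := p x) (b := p y) hx hy
      rw [this]
      group)
  refine ⟨K, hK, fun k hk => ⟨Nat.mul_pos hK hk, ?_⟩⟩
  have hmul : ∀ x ∈ X.TF, ∀ y ∈ X.TF, (x * y) ^ (K * k) = x ^ (K * k) * y ^ (K * k) := by
    intro x hx y hy
    have := (hH x hx _ (X.TF.pow_mem hy K)).2
    rw [pow_mul, (hH x hx y hy).1, this.mul_pow, ← pow_mul, ← pow_mul]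
  have hTF : ∀ t ∈ X.T, t ∈ X.TF := fun t ht => (X.section_T.mapsTo ht).2
  have hset : ∀ x ∈ X.TF, x ^ (K * k) ∈ powSet X.T (K * k) := by
    intro x hx
    obtain ⟨t, ht, htx⟩ := X.section_T.surjOn
      (show p x ∈ _ from ⟨⟨(x : Ort (Fin d₁) × Euc (Fin d₂)), x.2, rfl⟩, hx⟩)
    have htx' : p t = p x := htx
    refine ⟨t, ht, ?_⟩
    have hf : t⁻¹ * x ∈ p.ker := by
      rw [MonoidHom.mem_ker, map_mul, map_inv, htx', inv_mul_cancel]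
    have h := hmul t (hTF t ht) (t⁻¹ * x) (X.TF.mul_mem (X.TF.inv_mem (hTF t ht)) hx)
    rw [mul_inv_cancel_left, pow_mul (t⁻¹ * x), hF _ hf, one_pow, mul_one] at h
    exact h.symm
  have hset' : ∀ y ∈ powSet X.T (K * k), ∃ x ∈ X.TF, x ^ (K * k) = y := by
    rintro _ ⟨t, ht, rfl⟩
    exact ⟨t, hTF t ht, rfl⟩
  refine ⟨{ carrier := powSet X.T (K * k), one_mem' := ?_, mul_mem' := ?_, inv_mem' := ?_ },
    ⟨?_⟩, rfl⟩
  · intro a b ha hb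
    obtain ⟨x, hx, rfl⟩ := hset' a ha
    obtain ⟨y, hy, rfl⟩ := hset' b hb
    rw [← hmul x hx y hy]
    exact hset _ (X.TF.mul_mem hx hy)
  · simpa using hset 1 X.TF.one_mem
  · intro a ha
    obtain ⟨x, hx, rfl⟩ := hset' a ha
    rw [← inv_pow]
    exact hset _ (X.TF.inv_mem hx)
  · intro a ha g
    obtain ⟨x, hx, rfl⟩ := hset' a ha
    rw [← conj_pow]
    exact hset _ (Subgroup.Normal.conj_mem inferInstance x hx g)

/-- If `N ∈ M₀` divides `N'`, then `𝒯ᴺ`-periodic functions are invariant under `𝒯^{N'}`. -/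
theorem IsPeriodicWith.of_dvd {α : Type} {N N' : ℕ} (hN : N ∈ X.M₀) (hd : N ∣ N') {u : X.G → α}
    (hu : X.IsPeriodicWith N u) : X.IsPeriodicWith N' u := by
  obtain ⟨-, H, -, hH⟩ := hN
  obtain ⟨k, rfl⟩ := hd
  rintro g _ ⟨t, ht, rfl⟩
  apply hu
  rw [← hH]
  have h : t ^ N ∈ H := by
    rw [← SetLike.mem_coe, hH]
    exact ⟨t, ht, rfl⟩
  change t ^ (N * k) ∈ H
  rw [pow_mul]
  exact H.pow_mem h k

end periods

/-- The space `U_per` of periodic functions `u : 𝒢 → ℝᵈ`, with the uniform norm (periodic functions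
are bounded, as `𝒯ᴺ` has finite index in `𝒢` for `N ∈ M₀`). -/
def Uper : Submodule ℝ (lp (fun _ : X.G => Amb d₁ d₂) ∞) where
  carrier := {u | ∃ N ∈ X.M₀, X.IsPeriodicWith N u}
  zero_mem' := by
    obtain ⟨K, hK, h⟩ := X.exists_period
    exact ⟨_, h 1 one_pos, fun _ _ _ => rfl⟩
  add_mem' {u v} hu hv := by
    obtain ⟨N, hN, hu⟩ := hu
    obtain ⟨M, hM, hv⟩ := hv
    obtain ⟨K, hK, h⟩ := X.exists_period
    refine ⟨K * (N * M), h _ (Nat.mul_pos hN.1 hM.1), fun g t ht => ?_⟩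
    have h1 := IsPeriodicWith.of_dvd X hN (Dvd.intro (K * M) (by ring) : N ∣ K * (N * M)) hu g t ht
    have h2 := IsPeriodicWith.of_dvd X hM (Dvd.intro (K * N) (by ring) : M ∣ K * (N * M)) hv g t ht
    change u g + v g = u (g * t) + v (g * t)
    rw [h1, h2]
  smul_mem' c u hu := by
    obtain ⟨N, hN, hu⟩ := hu
    refine ⟨N, hN, fun g t ht => ?_⟩
    change c • u g = c • u (g * t)
    rw [hu g t ht]

/-- The value `u(g)` of a periodic function. -/
def val (u : X.Uper) (g : X.G) : Amb d₁ d₂ := (u : lp (fun _ : X.G => Amb d₁ d₂) ∞) g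

/-- The constant function `χ_𝒢 x`. -/
def const (x : Amb d₁ d₂) : X.Uper :=
  ⟨⟨fun _ => x, memℓp_infty ⟨‖x‖, by rintro _ ⟨g, rfl⟩; exact le_rfl⟩⟩, by
    obtain ⟨K, hK, h⟩ := X.exists_period
    exact ⟨_, h 1 one_pos, fun _ _ _ => rfl⟩⟩

/-- The least `N ∈ M₀` such that `u` is `𝒯ᴺ`-periodic. -/
def period (u : X.Uper) : ℕ := sInf {N | N ∈ X.M₀ ∧ X.IsPeriodicWith N (X.val u)}

/-- The average `|C N|⁻¹ ∑_{g ∈ C N} f(g)` over the (finite) representation set `C N`. -/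
def avg (C : ℕ → Set X.G) (N : ℕ) (f : X.G → ℝ) : ℝ := (∑ᶠ g ∈ C N, f g) / (C N).ncard

/-! ### Interaction potential and energy -/

/-- The index set `𝒢 ∖ {id}`. -/
abbrev Off : Type := {g : X.G // g ≠ 1}

/-- The reference configuration `y₀ = (g · x₀ - x₀)_{g ≠ id}`. -/
def y₀ (g : X.Off) : Amb d₁ d₂ := X.act g X.x₀ - X.x₀

/-- The function `z ↦ V(y + z)` on `L^∞(𝒢 ∖ {id}, ℝᵈ)`. -/
def shifted (V : (X.Off → Amb d₁ d₂) → ℝ) (y : X.Off → Amb d₁ d₂) :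
    lp (fun _ : X.Off => Amb d₁ d₂) ∞ → ℝ :=
  fun z => V fun g => y g + z g

/-- Interaction potentials of finite range: `O(d)`-invariance, smoothness in bounded directions, and
`V(y) = V(χ_{R_V} y)` for some finite `R_V ⊂ 𝒢 ∖ {id}`.  (For finite range, the first and second
partial derivatives of `V` have finite support, so they are summable.) -/
structure IsFiniteRangePotential (V : (X.Off → Amb d₁ d₂) → ℝ) : Prop where
  rotation : ∀ (A : Ort (Fin d₁ ⊕ Fin d₂)) (y : X.Off → Amb d₁ d₂), V (fun g => A (y g)) = V y
  smooth : ∀ y : X.Off → Amb d₁ d₂, ContDiff ℝ 2 (X.shifted V y)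
  finite_range : ∃ RV : Set X.Off, RV.Finite ∧ ∀ y, V y = V (RV.indicator y)

/-- `V'(y₀)`, a continuous linear functional on `L^∞(𝒢 ∖ {id}, ℝᵈ)`. -/
def siteDeriv (V : (X.Off → Amb d₁ d₂) → ℝ) : lp (fun _ : X.Off => Amb d₁ d₂) ∞ →L[ℝ] ℝ :=
  fderiv ℝ (X.shifted V X.y₀) 0

/-- The configurational energy
`E(w) = |C_N|⁻¹ ∑_{g ∈ C_N} V(((gh) · w(gh) - g · w(g))_{h ≠ id})`, for `𝒯ᴺ`-periodic `w`. -/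
def energy (C : ℕ → Set X.G) (V : (X.Off → Amb d₁ d₂) → ℝ) (w : X.Uper) : ℝ :=
  X.avg C (X.period w) fun g =>
    V fun h => X.act (g * h) (X.val w (g * h)) - X.act g (X.val w g)

/-- The second Fréchet derivative `E''(χ_𝒢 x₀)` as a bilinear form on `U_per`. -/
def hessian (C : ℕ → Set X.G) (V : (X.Off → Amb d₁ d₂) → ℝ) (u v : X.Uper) : ℝ :=
  fderiv ℝ (fderiv ℝ (X.energy C V)) (X.const X.x₀) u v

/-! ### Seminorms -/

/-- The space `Skew(d)` of skew symmetric matrices. -/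
def skew (d₁ d₂ : ℕ) : Submodule ℝ (Matrix (Fin d₁ ⊕ Fin d₂) (Fin d₁ ⊕ Fin d₂) ℝ) where
  carrier := {S | Sᵀ = -S}
  zero_mem' := by simp
  add_mem' {S S'} h h' := by
    change (S + S')ᵀ = -(S + S')
    rw [Matrix.transpose_add, show Sᵀ = -S from h, show S'ᵀ = -S' from h', neg_add]
  smul_mem' c S h := by
    change (c • S)ᵀ = -(c • S)
    rw [Matrix.transpose_smul, show Sᵀ = -S from h, smul_neg]

/-- The space `Skew_{0,0}(d)` of those skew symmetric matrices whose upper right `d₁ × d₂` block and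
lower right `d₂ × d₂` block vanish. -/
def skewZeroZero (d₁ d₂ : ℕ) : Submodule ℝ (Matrix (Fin d₁ ⊕ Fin d₂) (Fin d₁ ⊕ Fin d₂) ℝ) where
  carrier := {S | S ∈ skew d₁ d₂ ∧ S.toBlocks₁₂ = 0 ∧ S.toBlocks₂₂ = 0}
  zero_mem' := ⟨(skew d₁ d₂).zero_mem, rfl, rfl⟩
  add_mem' {S S'} h h' := ⟨(skew d₁ d₂).add_mem h.1 h'.1, by
      change S.toBlocks₁₂ + S'.toBlocks₁₂ = 0
      rw [h.2.1, h'.2.1, add_zero], by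
      change S.toBlocks₂₂ + S'.toBlocks₂₂ = 0
      rw [h.2.2, h'.2.2, add_zero]⟩
  smul_mem' c S h := ⟨(skew d₁ d₂).smul_mem c h.1, by
      change c • S.toBlocks₁₂ = 0
      rw [h.2.1, smul_zero], by
      change c • S.toBlocks₂₂ = 0
      rw [h.2.2, smul_zero]⟩

/-- The space of functions `u : R → ℝᵈ` with the Euclidean norm `(∑_{g ∈ R} ‖u(g)‖²)^{1/2}`. -/
abbrev FunR (R : Finset X.G) := PiLp 2 fun _ : R => Amb d₁ d₂

/-- `U_trans(R)`: those `u` for which some `a ∈ ℝᵈ` satisfies `rot(g) u(g) = a` on `R`. -/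
def Utrans (R : Finset X.G) : Submodule ℝ (X.FunR R) where
  carrier := {u | ∃ a, ∀ g : R, X.lin g (u g) = a}
  zero_mem' := ⟨0, fun g => map_zero (X.lin g)⟩
  add_mem' {u v} hu hv := by
    obtain ⟨a, ha⟩ := hu
    obtain ⟨b, hb⟩ := hv
    refine ⟨a + b, fun g => ?_⟩
    rw [PiLp.add_apply, map_add, ha, hb]
  smul_mem' c u hu := by
    obtain ⟨a, ha⟩ := hu
    refine ⟨c • a, fun g => ?_⟩
    rw [PiLp.smul_apply, map_smul, ha]

/-- Those `u : R → ℝᵈ` for which some `S ∈ 𝔰` satisfies `rot(g) u(g) = S (g · x₀ - x₀)` on `R`.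
This is `U_rot(R)` for `𝔰 = Skew(d)` and `U_{rot,0,0}(R)` for `𝔰 = Skew_{0,0}(d)`. -/
def Urot (𝔰 : Submodule ℝ (Matrix (Fin d₁ ⊕ Fin d₂) (Fin d₁ ⊕ Fin d₂) ℝ)) (R : Finset X.G) :
    Submodule ℝ (X.FunR R) where
  carrier := {u | ∃ S ∈ 𝔰, ∀ g : R, X.lin g (u g) = Matrix.toEuclideanLin S (X.act g X.x₀ - X.x₀)}
  zero_mem' := ⟨0, 𝔰.zero_mem, fun g => by simp⟩
  add_mem' {u v} hu hv := by
    obtain ⟨S, hS, ha⟩ := hu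
    obtain ⟨S', hS', hb⟩ := hv
    refine ⟨S + S', 𝔰.add_mem hS hS', fun g => ?_⟩
    rw [PiLp.add_apply, map_add, ha, hb, map_add, LinearMap.add_apply]
  smul_mem' c u hu := by
    obtain ⟨S, hS, ha⟩ := hu
    refine ⟨c • S, 𝔰.smul_mem c hS, fun g => ?_⟩
    rw [PiLp.smul_apply, map_smul, ha, map_smul, LinearMap.smul_apply]

/-- `U_trans(R) + U_rot(R)` with linear components in `𝔰`: this is `U_iso(R)` for `𝔰 = Skew(d)` and
`U_{iso,0,0}(R)` for `𝔰 = Skew_{0,0}(d)`. -/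
def Uiso (𝔰 : Submodule ℝ (Matrix (Fin d₁ ⊕ Fin d₂) (Fin d₁ ⊕ Fin d₂) ℝ)) (R : Finset X.G) :
    Submodule ℝ (X.FunR R) :=
  X.Utrans R ⊔ X.Urot 𝔰 R

/-- The seminorm `(|C_N|⁻¹ ∑_{g ∈ C_N} ‖π(u(g ·)|_R)‖²)^{1/2}` for `𝒯ᴺ`-periodic `u`, where `π` is the
orthogonal projection with kernel `U_iso(R)` resp. `U_{iso,0,0}(R)`. -/
def seminorm (C : ℕ → Set X.G)
    (𝔰 : Submodule ℝ (Matrix (Fin d₁ ⊕ Fin d₂) (Fin d₁ ⊕ Fin d₂) ℝ)) (R : Finset X.G)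
    (u : X.Uper) : ℝ :=
  √(X.avg C (X.period u) fun g =>
    ‖(X.Uiso 𝔰 R)ᗮ.starProjection (WithLp.toLp 2 fun h : R => X.val u (g * h))‖ ^ 2)

/-- The seminorm `‖·‖_R`. -/
def seminormR (C : ℕ → Set X.G) (R : Finset X.G) (u : X.Uper) : ℝ :=
  X.seminorm C (skew d₁ d₂) R u

/-- The seminorm `‖·‖_{R,0,0}`. -/
def seminormRZeroZero (C : ℕ → Set X.G) (R : Finset X.G) (u : X.Uper) : ℝ :=
  X.seminorm C (skewZeroZero d₁ d₂) R u

/-- Property 1: `R` is finite, `id ∈ R` and `aff(R · x₀) = aff(𝒢 · x₀)`. -/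
def Property1 (R : Set X.G) : Prop :=
  R.Finite ∧ 1 ∈ R ∧
    affineSpan ℝ ((fun g => X.act g X.x₀) '' R) = affineSpan ℝ (Set.range fun g => X.act g X.x₀)

/-- Property 2: `R` is finite and `R' R'' ⊂ R` for a generating set `R'` of `𝒢` that contains `id`
and a set `R''` with Property 1. -/
def Property2 (R : Set X.G) : Prop :=
  R.Finite ∧ ∃ R' R'' : Set X.G, 1 ∈ R' ∧ Subgroup.closure R' = ⊤ ∧ X.Property1 R'' ∧
    ∀ a ∈ R', ∀ b ∈ R'', a * b ∈ R

/-- `λ_a`, an element of the extended reals. -/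
def lambdaA (C : ℕ → Set X.G) (V : (X.Off → Amb d₁ d₂) → ℝ) (R : Finset X.G) : EReal :=
  sSup ((fun c : ℝ => (c : EReal)) ''
    {c | ∀ u : X.Uper, c * X.seminormR C R u ^ 2 ≤ X.hessian C V u u})

/-- `λ_{a,0,0}`, an element of the extended reals. -/
def lambdaAZeroZero (C : ℕ → Set X.G) (V : (X.Off → Amb d₁ d₂) → ℝ) (R : Finset X.G) : EReal :=
  sSup ((fun c : ℝ => (c : EReal)) ''
    {c | ∀ u : X.Uper, c * X.seminormRZeroZero C R u ^ 2 ≤ X.hessian C V u u})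

end ObjectiveStructure
end ObjStr
end

/-! Rotating the configuration seen from `g` by `rot(g)⁻¹` turns its entries into `h · w(gh) -
w(g)`. By finite range, `V` becomes a function `v` of finitely many of these, so `E(w) = M (v ∘ (L w
+ c))`. Here `L` is bounded and linear with values in bounded families of finite-dimensional
vectors, and `M` is one continuous functional extending the mean of periodic functions.
Superposition by a `C²` function of finitely many variables is `C²` for the sup norm. Hence `E` is
`C²`, and `E''` at the identity deformation averages `v''(y₀)(Lu(g), Lu'(g))` over `g`.

Two facts give the bound. First, `v'(y₀) = 0` and rotation invariance make `v'` vanish on the whole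
`O(d)`-orbit of `y₀`. Differentiating along `exp(tS) y₀` puts every `S y₀`, `S` skew, in the kernel
of the symmetric form `v''(y₀)` (`fderiv_fderiv_apply_skewAdjoint`), so each argument `Lu(g)` may be
changed by such a vector.

Second, some `S y₀` is close to `Lu(g)`, with error at most a constant times finitely many shifted
local distances of `u` to `U_iso(R)` (`exists_relDisp_sub_skew_bound`). The best rigid
approximations at `g` and `gr`, for a generator `r`, overlap on enough points to be compared on the
affine hull of the orbit; a cocycle identity extends the comparison to all group elements.
Cauchy–Schwarz and shift invariance of averages finish the estimate.

For the two suprema, `-K` is admissible, and one periodic function of positive seminorm bounds them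
above. -/

namespace ObjStr

/-! ### Superposition operators on bounded functions -/

section superposition

variable {ι W E : Type} [NormedAddCommGroup W] [NormedAddCommGroup E]

section

variable [ProperSpace W]

/-- The superposition operator `f ↦ A ∘ f` on bounded functions. -/
noncomputable def superpose (A : W → E) (hA : Continuous A) (f : lp (fun _ : ι => W) ∞) :
    lp (fun _ : ι => E) ∞ :=
  ⟨fun i => A (f i), memℓp_infty (by
    -- All values of `f` lie in one closed ball, compact because `W` is proper, so `A` is bounded on
    -- them.
    obtain ⟨B, hB⟩ := ((isCompact_closedBall (0 : W) ‖f‖).image hA).isBounded.exists_norm_le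
    refine ⟨B, ?_⟩
    rintro _ ⟨i, rfl⟩
    exact hB _ ⟨f i, by simpa using lp.norm_apply_le_norm ENNReal.top_ne_zero f i, rfl⟩)⟩

/-- For `g` within distance 1 of `f`, all values of both lie in the compact ball of radius `‖f‖ +
1`. Uniform continuity of `A` there gives one `δ` for every index. -/
theorem continuous_superpose (A : W → E) (hA : Continuous A) :
    Continuous (superpose (ι := ι) A hA) := by
  rw [Metric.continuous_iff]
  intro f ε hε
  have hu := (isCompact_closedBall (0 : W) (‖f‖ + 1)).uniformContinuousOn_of_continuous
    hA.continuousOn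
  obtain ⟨δ, hδ, h⟩ := Metric.uniformContinuousOn_iff.1 hu (ε / 2) (by positivity)
  refine ⟨min δ 1, by positivity, fun g hg => ?_⟩
  rw [dist_eq_norm] at hg ⊢
  refine (lp.norm_le_of_forall_le (C := ε / 2) (by positivity) fun i => ?_).trans_lt (by linarith)
  have hi : ‖g i - f i‖ < min δ 1 :=
    (lp.norm_apply_le_norm ENNReal.top_ne_zero (g - f) i).trans_lt hg
  have hf := lp.norm_apply_le_norm ENNReal.top_ne_zero f i
  have hgi : ‖g i‖ ≤ ‖f‖ + 1 := by
    have := norm_le_norm_add_norm_sub' (g i) (f i)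
    have := hi.le.trans (min_le_right _ _)
    linarith
  have := h (g i) (by simpa using hgi) (f i) (by simpa using hf.trans (by linarith))
    (by rw [dist_eq_norm]; exact hi.trans_le (min_le_left _ _))
  rw [dist_eq_norm] at this
  exact this.le

end

variable [NormedSpace ℝ W] [NormedSpace ℝ E]

variable (ι W E) in
/-- Pointwise application of a bounded family of operators to a bounded family of vectors. -/
noncomputable def applyBounded :
    lp (fun _ : ι => W →L[ℝ] E) ∞ →L[ℝ] lp (fun _ : ι => W) ∞ →L[ℝ] lp (fun _ : ι => E) ∞ :=
  have key : ∀ (T : lp (fun _ : ι => W →L[ℝ] E) ∞) (f : lp (fun _ : ι => W) ∞) (i : ι),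
      ‖T i (f i)‖ ≤ ‖T‖ * ‖f‖ := fun T f i =>
    (T i).le_of_opNorm_le_of_le (lp.norm_apply_le_norm ENNReal.top_ne_zero T i)
      (lp.norm_apply_le_norm ENNReal.top_ne_zero f i)
  LinearMap.mkContinuous₂
    (LinearMap.mk₂ ℝ
      (fun T f => (⟨fun i => T i (f i), memℓp_infty ⟨‖T‖ * ‖f‖, by
        rintro _ ⟨i, rfl⟩
        exact key T f i⟩⟩ : lp (fun _ : ι => E) ∞))
      (fun T T' f => by ext i; simp; rfl)
      (fun c T f => by ext i; simp)
      (fun T f f' => by ext i; simp; rfl)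
      (fun c T f => by ext i; simp))
    1 (fun T f => by
      rw [one_mul]
      exact lp.norm_le_of_forall_le (by positivity) (key T f))

/-- The pointwise remainder must be small uniformly in the index. The mean value inequality bounds
it by the oscillation of `A'` near `f i`, and `A'` is uniformly continuous on the compact ball
containing all values. -/
theorem hasFDerivAt_superpose [ProperSpace W] (A : W → E) (A' : W → W →L[ℝ] E) (hA' : Continuous A')
    (h : ∀ x, HasFDerivAt A (A' x) x) (hA : Continuous A) (f : lp (fun _ : ι => W) ∞) :
    HasFDerivAt (superpose A hA) (applyBounded ι W E (superpose A' hA' f)) f := by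
  rw [hasFDerivAt_iff_isLittleO, Asymptotics.isLittleO_iff]
  intro ε hε
  have hu := (isCompact_closedBall (0 : W) (‖f‖ + 1)).uniformContinuousOn_of_continuous
    hA'.continuousOn
  obtain ⟨δ, hδ, hδε⟩ := Metric.uniformContinuousOn_iff.1 hu ε hε
  filter_upwards [Metric.ball_mem_nhds f (show 0 < min δ 1 by positivity)] with g hg
  rw [Metric.mem_ball, dist_eq_norm] at hg
  refine lp.norm_le_of_forall_le (by positivity) fun i => ?_
  have hgf := lp.norm_apply_le_norm ENNReal.top_ne_zero (g - f) i
  have hi : ‖g i - f i‖ < min δ 1 := hgf.trans_lt hg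
  have hf := lp.norm_apply_le_norm ENNReal.top_ne_zero f i
  have hball : ∀ x ∈ Metric.ball (f i) (min δ 1), ‖A' x - A' (f i)‖ ≤ ε := by
    intro x hx
    rw [Metric.mem_ball, dist_eq_norm] at hx
    have hxn : ‖x‖ ≤ ‖f‖ + 1 := by
      have := norm_le_norm_add_norm_sub' x (f i)
      have := hx.le.trans (min_le_right _ _)
      linarith
    have := hδε x (by simpa using hxn) (f i) (by simpa using hf.trans (by linarith))
      (by rw [dist_eq_norm]; exact hx.trans_le (min_le_left _ _))
    rw [dist_eq_norm] at this
    exact this.le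
  have := Convex.norm_image_sub_le_of_norm_hasFDerivWithin_le'
    (fun x _ => (h x).hasFDerivWithinAt) hball (convex_ball (f i) (min δ 1))
    (Metric.mem_ball_self (by positivity))
    (show g i ∈ _ by rwa [Metric.mem_ball, dist_eq_norm])
  exact this.trans (mul_le_mul_of_nonneg_left hgf hε.le)

/-- The derivative is superposition by `A'` followed by a continuous linear map, so induction
applies. The target `E` is generalized because `A'` takes values in `W →L[ℝ] E`. -/
theorem contDiff_superpose [ProperSpace W] (n : ℕ) {E : Type} [NormedAddCommGroup E] [NormedSpace ℝ E]
    (A : W → E) (hA : ContDiff ℝ n A) :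
    ContDiff ℝ n (superpose (ι := ι) A hA.continuous) := by
  induction n generalizing E with
  | zero => exact contDiff_zero.2 (continuous_superpose A hA.continuous)
  | succ n ih =>
    obtain ⟨A', hA', h⟩ := contDiff_succ_iff_hasFDerivAt.1 hA
    refine contDiff_succ_iff_hasFDerivAt.2
      ⟨fun f => applyBounded ι W E (superpose A' hA'.continuous f), ?_,
        hasFDerivAt_superpose A A' hA'.continuous h hA.continuous⟩
    exact (applyBounded ι W E).contDiff.comp (ih A' hA')

end superposition

/-! ### Translations, discrete orbits and cocompactness -/

theorem translation_pow_apply {ι : Type} [Fintype ι] {a : Euc ι} (ha : IsTranslation a) (n : ℕ)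
    (x : Vec ι) : (a ^ n) x = x + n • trans a := by
  induction n with
  | zero => simp
  | succ n ih =>
    rw [pow_succ', AffineIsometryEquiv.coe_mul, Function.comp, ih,
      ObjectiveStructure.translation_apply ha, succ_nsmul, add_assoc]
    rfl

/-- The additive group of translation components of a subgroup of the Euclidean group. -/
def translationLattice {ι : Type} [Fintype ι] (Γ : Subgroup (Euc ι)) : AddSubgroup (Vec ι) where
  carrier := {τ | ∃ a ∈ Γ, IsTranslation a ∧ trans a = τ}
  zero_mem' := ⟨1, Γ.one_mem, rfl, rfl⟩
  add_mem' := by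
    rintro _ _ ⟨a, ha, hta, rfl⟩ ⟨b, hb, htb, rfl⟩
    refine ⟨b * a, Γ.mul_mem hb ha, ?_, ?_⟩
    · change rot b * rot a = 1
      rw [show rot a = 1 from hta, show rot b = 1 from htb, one_mul]
    · exact ObjectiveStructure.translation_apply htb (a 0)
  neg_mem' := by
    rintro _ ⟨a, ha, hta, rfl⟩
    refine ⟨a⁻¹, Γ.inv_mem ha, ?_, ?_⟩
    · change (rot a)⁻¹ = 1
      rw [show rot a = 1 from hta, inv_one]
    · have h := ObjectiveStructure.translation_apply hta (a⁻¹ 0)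
      have h1 : a (a⁻¹ 0) = 0 := a.apply_symm_apply 0
      rw [h1] at h
      exact eq_neg_of_add_eq_zero_left h.symm

namespace ObjectiveStructure

variable {d₁ d₂ : ℕ} (X : ObjectiveStructure d₁ d₂)

@[simp] theorem act_one (x : Amb d₁ d₂) : X.act 1 x = x := by simp [act]

theorem lin_mul (g h : X.G) (x : Amb d₁ d₂) : X.lin (g * h) x = X.lin g (X.lin h x) := by
  rw [lin, Subgroup.coe_mul, map_mul]
  rfl

@[simp] theorem lin_one (x : Amb d₁ d₂) : X.lin 1 x = x := by
  rw [lin, Subgroup.coe_one, map_one]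
  rfl

theorem act_sub (g : X.G) (x y : Amb d₁ d₂) : X.act g x - X.act g y = X.lin g (x - y) :=
  ((oplus (g : Ort (Fin d₁) × Euc (Fin d₂))).map_vsub x y).symm

/-- The group acts by isometries, so the isolation radius of `x₀` in its orbit serves at every orbit
point. A uniformly separated orbit meets each ball in finitely many points, and `g ↦ g · x₀` is
injective. -/
theorem finite_norm_act_le (r : ℝ) : Set.Finite {g : X.G | ‖X.act g X.x₀‖ ≤ r} := by
  have hO : ∀ g, X.act g X.x₀ ∈ Set.range fun g : X.G.map oplus => (g : Euc _) X.x₀ :=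
    fun g => ⟨⟨oplus (g : Ort (Fin d₁) × Euc (Fin d₂)), g, g.2, rfl⟩, rfl⟩
  have hO2 : ∀ p ∈ Set.range fun g : X.G.map oplus => (g : Euc _) X.x₀,
      ∃ g, p = X.act g X.x₀ := by
    rintro _ ⟨⟨_, g, hg, rfl⟩, rfl⟩
    exact ⟨⟨g, hg⟩, rfl⟩
  have hd := X.discrete X.x₀
  set O := Set.range fun g : X.G.map oplus => (g : Euc _) X.x₀ with hOdef
  have hx : X.x₀ ∈ O := X.act_one X.x₀ ▸ hO 1
  obtain ⟨ε, hε, hball⟩ := Metric.exists_ball_inter_eq_singleton_of_mem_discrete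
    (isDiscrete_iff_discreteTopology.2 hd) hx
  have hdist : ∀ (g : X.G) x y, dist (X.act g x) (X.act g y) = dist x y := fun g x y =>
    (oplus (g : Ort (Fin d₁) × Euc (Fin d₂))).dist_map x y
  have hsep : O.Pairwise fun x y => ε ≤ dist x y := by
    intro p hp q hq hpq
    obtain ⟨g, rfl⟩ := hO2 p hp
    obtain ⟨h, rfl⟩ := hO2 q hq
    by_contra hlt
    push Not at hlt
    have e : dist (X.act g X.x₀) (X.act h X.x₀) = dist X.x₀ (X.act (g⁻¹ * h) X.x₀) := by
      rw [← hdist g X.x₀, ← act_mul, mul_inv_cancel_left]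
    have hm : X.act (g⁻¹ * h) X.x₀ ∈ Metric.ball X.x₀ ε ∩ O :=
      ⟨by rw [Metric.mem_ball, dist_comm, ← e]; exact hlt, hO _⟩
    rw [hball] at hm
    apply hpq
    have := congrArg (X.act g) (Set.mem_singleton_iff.1 hm)
    rw [← act_mul, mul_inv_cancel_left] at this
    exact this.symm
  have hfin : Set.Finite (Metric.closedBall 0 r ∩ O) :=
    Metric.finite_isBounded_inter_isClosed (isDiscrete_iff_discreteTopology.2 hd)
      Metric.isBounded_closedBall (Metric.isClosed_of_pairwise_le_dist hε hsep)
  refine Set.Finite.of_finite_image (hfin.subset ?_) (X.injective.injOn)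
  rintro _ ⟨f, hf, rfl⟩
  exact ⟨mem_closedBall_zero_iff.2 hf, hO f⟩

/-- Elements of `𝒢` preserve the norm of the first component. The second can be moved by `N` times a
lattice vector into `N` times a fundamental parallelepiped, whose size does not depend on `g`. -/
theorem exists_mem_powSet_norm_act_le {N : ℕ} (hN : 0 < N) :
    ∃ r, ∀ g, ∃ h ∈ powSet X.T N, ‖X.act (h * g) X.x₀‖ ≤ r := by
  obtain ⟨-, s, hs, hli⟩ := X.spaceGroup
  set b : Module.Basis (Fin d₂) ℝ (Vec (Fin d₂)) := Module.Basis.mk hli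
    (hli.span_eq_top_of_card_eq_finrank' (by simp)).ge with hb
  refine ⟨‖fstPart X.x₀‖ + N * ∑ i, ‖b i‖, fun g => ?_⟩
  set y := sndPart (X.act g X.x₀) with hy
  set z := ZSpan.fract b ((N : ℝ)⁻¹ • y) with hz
  have hspan : Submodule.span ℤ (Set.range b) ≤
      (translationLattice (X.G.map (MonoidHom.snd _ _))).toIntSubmodule := by
    rw [Submodule.span_le]
    rintro _ ⟨i, rfl⟩
    exact ⟨s i, (hs i).1, (hs i).2, by simp [hb]⟩
  -- Subtracting the integer part of `N⁻¹ y` is a translation in `𝒮`; its `N`-th power moves `y` to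
  -- `N` times the fractional part.
  obtain ⟨σ, hσ, hσt, hσz⟩ := neg_mem (hspan (ZSpan.floor b ((N : ℝ)⁻¹ • y)).2)
  obtain ⟨t, ht, rfl⟩ := X.section_T.surjOn ⟨hσ, hσt⟩
  refine ⟨t ^ N, ⟨t, ht, rfl⟩, ?_⟩
  have h1 : ‖fstPart (X.act (t ^ N * g) X.x₀)‖ = ‖fstPart X.x₀‖ := by
    rw [act, oplus_apply, fstPart_join, LinearIsometryEquiv.norm_map]
  have hN' : (N : ℝ) ≠ 0 := by positivity
  have h2 : sndPart (X.act (t ^ N * g) X.x₀) = (N : ℝ) • z := by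
    rw [act_mul, act, oplus_apply, sndPart_join]
    change ((t : Ort (Fin d₁) × Euc (Fin d₂)).2 ^ N) y = _
    rw [translation_pow_apply hσt, hσz, hz, ZSpan.fract_apply, smul_sub, smul_inv_smul₀ hN',
      ← Nat.cast_smul_eq_nsmul ℝ, smul_neg, sub_eq_add_neg]
  have h3 : ‖sndPart (X.act (t ^ N * g) X.x₀)‖ ≤ N * ∑ i, ‖b i‖ := by
    rw [h2, norm_smul, Real.norm_natCast]
    exact mul_le_mul_of_nonneg_left (ZSpan.norm_fract_le b _) (by positivity)
  have h4 := norm_join_sq (fstPart (X.act (t ^ N * g) X.x₀)) (sndPart (X.act (t ^ N * g) X.x₀))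
  rw [join_parts, h1] at h4
  refine le_trans (abs_le_of_sq_le_sq' ?_ (by positivity)).2 (add_le_add_right h3 _)
  rw [h4]
  nlinarith [mul_nonneg (norm_nonneg (fstPart X.x₀))
    (norm_nonneg (sndPart (X.act (t ^ N * g) X.x₀)))]

/-! ### Averages of periodic functions -/

section averages

variable {X} {C : ℕ → Set X.G}

theorem IsRepSystem.bijOn (hC : X.IsRepSystem C) {N : ℕ} (hN : N ∈ X.M₀) {H : Subgroup X.G}
    (hH : (H : Set X.G) = powSet X.T N) :
    Set.BijOn (QuotientGroup.mk : X.G → X.G ⧸ H) (C N) Set.univ := by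
  refine ⟨fun _ _ => trivial, fun a ha b hb hab => ?_, fun q _ => ?_⟩
  · refine (hC N hN b).unique ⟨ha, ?_⟩ ⟨hb, ?_⟩
    · rw [← hH]
      exact QuotientGroup.eq.1 hab
    · rw [← hH, inv_mul_cancel]
      exact H.one_mem
  · obtain ⟨g, rfl⟩ := QuotientGroup.mk_surjective q
    obtain ⟨c, ⟨hc, hcg⟩, -⟩ := hC N hN g
    refine ⟨c, hc, QuotientGroup.eq.2 ?_⟩
    rwa [← SetLike.mem_coe, hH]

/-- By normality `hg` lies in the coset of `g` for `h ∈ 𝒯ᴺ`. So every coset has a representative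
with orbit point in a fixed ball, and there are finitely many of these. -/
theorem IsRepSystem.finite (hC : X.IsRepSystem C) {N : ℕ} (hN : N ∈ X.M₀) : (C N).Finite := by
  obtain ⟨H, hn, hH⟩ := hN.2
  obtain ⟨r, hr⟩ := X.exists_mem_powSet_norm_act_le hN.1
  have hb := hC.bijOn hN hH
  refine Set.Finite.of_finite_image (f := (QuotientGroup.mk : X.G → X.G ⧸ H)) ?_ hb.injOn
  refine ((X.finite_norm_act_le r).image (QuotientGroup.mk : X.G → X.G ⧸ H)).subset ?_
  rintro _ ⟨g, -, rfl⟩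
  obtain ⟨h, hh, hle⟩ := hr g
  refine ⟨h * g, hle, QuotientGroup.eq.2 ?_⟩
  rw [← hH] at hh
  have := hn.conj_mem _ (H.inv_mem hh) g⁻¹
  simpa [mul_assoc] using this

theorem IsRepSystem.nonempty (hC : X.IsRepSystem C) {N : ℕ} (hN : N ∈ X.M₀) : (C N).Nonempty := by
  obtain ⟨c, ⟨hc, -⟩, -⟩ := hC N hN 1
  exact ⟨c, hc⟩

theorem IsRepSystem.avg_eq_sum (hC : X.IsRepSystem C) {N : ℕ} (hN : N ∈ X.M₀) (f : X.G → ℝ) :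
    X.avg C N f = (∑ g ∈ (hC.finite hN).toFinset, f g) / (C N).ncard := by
  rw [avg, finsum_mem_eq_finite_toFinset_sum]

theorem IsRepSystem.ncard_pos (hC : X.IsRepSystem C) {N : ℕ} (hN : N ∈ X.M₀) :
    0 < ((C N).ncard : ℝ) := by
  exact_mod_cast (Set.ncard_pos (hC.finite hN)).2 (hC.nonempty hN)

theorem IsRepSystem.avg_const (hC : X.IsRepSystem C) {N : ℕ} (hN : N ∈ X.M₀) (c : ℝ) :
    X.avg C N (fun _ => c) = c := by
  have := hC.ncard_pos hN
  rw [hC.avg_eq_sum hN, Finset.sum_const, ← Set.ncard_eq_toFinset_card (C N) (hC.finite hN), nsmul_eq_mul]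
  field_simp

theorem IsRepSystem.avg_mono (hC : X.IsRepSystem C) {N : ℕ} (hN : N ∈ X.M₀) {f f' : X.G → ℝ}
    (h : ∀ g, f g ≤ f' g) : X.avg C N f ≤ X.avg C N f' := by
  rw [hC.avg_eq_sum hN, hC.avg_eq_sum hN]
  gcongr
  exact h _

theorem IsRepSystem.avg_add (hC : X.IsRepSystem C) {N : ℕ} (hN : N ∈ X.M₀) (f f' : X.G → ℝ) :
    X.avg C N (fun g => f g + f' g) = X.avg C N f + X.avg C N f' := by
  simp only [hC.avg_eq_sum hN, Finset.sum_add_distrib, add_div]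

theorem IsRepSystem.avg_smul (hC : X.IsRepSystem C) {N : ℕ} (hN : N ∈ X.M₀) (c : ℝ)
    (f : X.G → ℝ) : X.avg C N (fun g => c * f g) = c * X.avg C N f := by
  simp only [hC.avg_eq_sum hN, ← Finset.mul_sum, mul_div_assoc]

theorem IsRepSystem.avg_sum (hC : X.IsRepSystem C) {N : ℕ} (hN : N ∈ X.M₀) {κ : Type}
    (s : Finset κ) (f : κ → X.G → ℝ) :
    X.avg C N (fun g => ∑ i ∈ s, f i g) = ∑ i ∈ s, X.avg C N (f i) := by
  simp only [hC.avg_eq_sum hN, ← Finset.sum_div]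
  rw [Finset.sum_comm]

theorem IsRepSystem.abs_avg_le (hC : X.IsRepSystem C) {N : ℕ} (hN : N ∈ X.M₀) (f : X.G → ℝ) :
    |X.avg C N f| ≤ X.avg C N fun g => |f g| := by
  rw [hC.avg_eq_sum hN, hC.avg_eq_sum hN, abs_div, abs_of_pos (hC.ncard_pos hN)]
  gcongr
  exact Finset.abs_sum_le_sum_abs _ _

theorem IsRepSystem.avg_mul_le (hC : X.IsRepSystem C) {N : ℕ} (hN : N ∈ X.M₀) (f f' : X.G → ℝ) :
    X.avg C N (fun g => f g * f' g) ≤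
      √(X.avg C N fun g => f g ^ 2) * √(X.avg C N fun g => f' g ^ 2) := by
  have hp := hC.ncard_pos hN
  rw [← Real.sqrt_mul (by rw [hC.avg_eq_sum hN]; positivity)]
  apply Real.le_sqrt_of_sq_le
  simp only [hC.avg_eq_sum hN]
  rw [div_pow, div_mul_div_comm, ← sq ((C N).ncard : ℝ)]
  exact div_le_div_of_nonneg_right (Finset.sum_mul_sq_le_sq_mul_sq _ f f') (by positivity)

theorem IsRepSystem.avg_comm (hC : X.IsRepSystem C) {N N' : ℕ} (hN : N ∈ X.M₀) (hN' : N' ∈ X.M₀)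
    (f : X.G → X.G → ℝ) :
    X.avg C N (fun g => X.avg C N' (f g)) = X.avg C N' fun s => X.avg C N fun g => f g s := by
  simp only [hC.avg_eq_sum hN, hC.avg_eq_sum hN', ← Finset.sum_div, div_div]
  rw [Finset.sum_comm, mul_comm]

theorem IsPeriodicWith.exists_quotient {α : Type} {N : ℕ} {f : X.G → α}
    (hf : X.IsPeriodicWith N f) {H : Subgroup X.G} (hH : (H : Set X.G) = powSet X.T N) :
    ∃ F : X.G ⧸ H → α, ∀ g, f g = F g := by
  refine ⟨fun q => f q.out, fun g => ?_⟩
  obtain ⟨h, hh⟩ := QuotientGroup.mk_out_eq_mul H g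
  change f g = f (Quotient.out (g : X.G ⧸ H))
  rw [hh]
  exact hf g h (hH ▸ h.2)

theorem IsRepSystem.avg_eq_finsum (hC : X.IsRepSystem C) {N : ℕ} (hN : N ∈ X.M₀)
    {H : Subgroup X.G} (hH : (H : Set X.G) = powSet X.T N) (F : X.G ⧸ H → ℝ) :
    X.avg C N (fun g => F g) = (∑ᶠ q, F q) / (C N).ncard := by
  rw [avg, finsum_mem_eq_of_bijOn _ (hC.bijOn hN hH) (fun _ _ => rfl), finsum_mem_univ]

/-- Since `𝒯ᴺ` is normal, right multiplication by `s` descends to a permutation of the quotient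
group. -/
theorem IsRepSystem.avg_mul_right (hC : X.IsRepSystem C) {N : ℕ} (hN : N ∈ X.M₀) {f : X.G → ℝ}
    (hf : X.IsPeriodicWith N f) (s : X.G) : X.avg C N (fun g => f (g * s)) = X.avg C N f := by
  obtain ⟨H, hn, hH⟩ := hN.2
  obtain ⟨F, hF⟩ := hf.exists_quotient hH
  obtain rfl : f = fun g : X.G => F g := funext hF
  rw [hC.avg_eq_finsum hN hH F, ← finsum_comp_equiv (Equiv.mulRight (s : X.G ⧸ H)),
    ← hC.avg_eq_finsum hN hH]
  rfl

theorem IsRepSystem.avg_mul_left (hC : X.IsRepSystem C) {N : ℕ} (hN : N ∈ X.M₀) {f : X.G → ℝ}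
    (hf : X.IsPeriodicWith N f) (s : X.G) : X.avg C N (fun g => f (s * g)) = X.avg C N f := by
  obtain ⟨H, hn, hH⟩ := hN.2
  obtain ⟨F, hF⟩ := hf.exists_quotient hH
  obtain rfl : f = fun g : X.G => F g := funext hF
  rw [hC.avg_eq_finsum hN hH F, ← finsum_comp_equiv (Equiv.mulLeft (s : X.G ⧸ H)),
    ← hC.avg_eq_finsum hN hH]
  rfl

/-- The double average of `f(gs)` over `g ∈ C N'` and `s ∈ C N`, evaluated in both orders, gives
each side; no index has to be computed. -/
theorem IsRepSystem.avg_of_dvd (hC : X.IsRepSystem C) {N N' : ℕ} (hN : N ∈ X.M₀) (hN' : N' ∈ X.M₀)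
    (hd : N ∣ N') {f : X.G → ℝ} (hf : X.IsPeriodicWith N f) : X.avg C N' f = X.avg C N f := by
  have hf' := hf.of_dvd X hN hd
  calc X.avg C N' f = X.avg C N fun s => X.avg C N' fun g => f (g * s) := by
        simp only [hC.avg_mul_right hN' hf', hC.avg_const hN]
    _ = X.avg C N' fun g => X.avg C N fun s => f (g * s) := hC.avg_comm hN hN' _
    _ = X.avg C N f := by simp only [hC.avg_mul_left hN hf, hC.avg_const hN']

theorem exists_common_period {N N' : ℕ} (hN : N ∈ X.M₀) (hN' : N' ∈ X.M₀) :
    ∃ P ∈ X.M₀, N ∣ P ∧ N' ∣ P := by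
  obtain ⟨K, hK, h⟩ := X.exists_period
  exact ⟨_, h _ (Nat.mul_pos hN.1 hN'.1), ⟨K * N', by ring⟩, ⟨K * N, by ring⟩⟩

theorem IsRepSystem.avg_eq_avg (hC : X.IsRepSystem C) {N N' : ℕ} (hN : N ∈ X.M₀)
    (hN' : N' ∈ X.M₀) {f : X.G → ℝ} (hf : X.IsPeriodicWith N f) (hf' : X.IsPeriodicWith N' f) :
    X.avg C N f = X.avg C N' f := by
  obtain ⟨P, hP, h, h'⟩ := exists_common_period hN hN'
  rw [← hC.avg_of_dvd hN hP h hf, hC.avg_of_dvd hN' hP h' hf']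

variable (X) in
/-- The space of bounded real-valued periodic functions on `𝒢`. -/
def realPeriodic : Submodule ℝ (lp (fun _ : X.G => ℝ) ∞) where
  carrier := {u | ∃ N ∈ X.M₀, X.IsPeriodicWith N u}
  zero_mem' := by
    obtain ⟨K, hK, h⟩ := X.exists_period
    exact ⟨_, h 1 one_pos, fun _ _ _ => rfl⟩
  add_mem' {u v} hu hv := by
    obtain ⟨N, hN, hu⟩ := hu
    obtain ⟨M, hM, hv⟩ := hv
    obtain ⟨P, hP, h, h'⟩ := exists_common_period hN hM
    exact ⟨P, hP, fun g t ht =>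
      congrArg₂ (· + ·) (hu.of_dvd X hN h g t ht) (hv.of_dvd X hM h' g t ht)⟩
  smul_mem' c u hu := by
    obtain ⟨N, hN, hu⟩ := hu
    exact ⟨N, hN, fun g t ht => congrArg (c * ·) (hu g t ht)⟩

/-- Different functions have different periods, so the mean is defined on the subspace of all
periodic functions. It has norm at most 1 there, and Hahn–Banach extends it. Only its values on
periodic functions are used. -/
theorem IsRepSystem.exists_mean (hC : X.IsRepSystem C) :
    ∃ M : lp (fun _ : X.G => ℝ) ∞ →L[ℝ] ℝ, ∀ (f : lp (fun _ : X.G => ℝ) ∞) (N : ℕ), N ∈ X.M₀ →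
      X.IsPeriodicWith N f → M f = X.avg C N f := by
  have hex : ∀ f : X.realPeriodic, ∃ N, N ∈ X.M₀ ∧ X.IsPeriodicWith N f.1 := fun f => f.2
  choose p hp hper using hex
  have hm : ∀ (f : X.realPeriodic) (N : ℕ), N ∈ X.M₀ → X.IsPeriodicWith N f.1 →
      X.avg C (p f) f.1 = X.avg C N f.1 := fun f N hN hf => hC.avg_eq_avg (hp f) hN (hper f) hf
  have hadd : ∀ f f' : X.realPeriodic, X.avg C (p (f + f')) (f + f').1 =
      X.avg C (p f) f.1 + X.avg C (p f') f'.1 := fun f f' => by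
    obtain ⟨P, hP, h, h'⟩ := exists_common_period (hp f) (hp f')
    have h1 := (hper f).of_dvd X (hp f) h
    have h2 := (hper f').of_dvd X (hp f') h'
    have h3 : X.IsPeriodicWith P (f + f').1 := fun g t ht =>
      congrArg₂ (· + ·) (h1 g t ht) (h2 g t ht)
    rw [hm f P hP h1, hm f' P hP h2, hm (f + f') P hP h3]
    exact hC.avg_add hP _ _
  have hsmul : ∀ (c : ℝ) (f : X.realPeriodic), X.avg C (p (c • f)) (c • f).1 =
      c * X.avg C (p f) f.1 := fun c f => by
    have h3 : X.IsPeriodicWith (p f) (c • f).1 := fun g t ht => congrArg (c * ·) (hper f g t ht)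
    rw [hm (c • f) _ (hp f) h3]
    exact hC.avg_smul (hp f) _ _
  have hle : ∀ f : X.realPeriodic, ‖X.avg C (p f) f.1‖ ≤ 1 * ‖f‖ := fun f => by
    refine (hC.abs_avg_le (hp f) _).trans ?_
    refine (hC.avg_mono (hp f) (f' := fun _ => 1 * ‖f‖) fun g => ?_).trans
      (hC.avg_const (hp f) _).le
    rw [one_mul]
    exact lp.norm_apply_le_norm ENNReal.top_ne_zero f.1 g
  let m : X.realPeriodic →ₗ[ℝ] ℝ :=
    { toFun := fun f => X.avg C (p f) f.1
      map_add' := hadd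
      map_smul' := hsmul }
  obtain ⟨M, hM, -⟩ := exists_extension_norm_eq X.realPeriodic (m.mkContinuous 1 hle)
  exact ⟨M, fun f N hN hf => (hM ⟨f, N, hN, hf⟩).trans (hm ⟨f, N, hN, hf⟩ N hN hf)⟩

end averages

end ObjectiveStructure

/-- The second derivative at `x` of a functional of the form `w ↦ M (v ∘ (L w + c))`. -/
theorem contDiff_two_and_fderiv_fderiv_superpose {ι U W : Type} [NormedAddCommGroup U]
    [NormedSpace ℝ U] [NormedAddCommGroup W] [NormedSpace ℝ W] [ProperSpace W]
    (M : lp (fun _ : ι => ℝ) ∞ →L[ℝ] ℝ) {v : W → ℝ} (hv : ContDiff ℝ 2 v)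
    (hv₂ : Continuous (fderiv ℝ (fderiv ℝ v))) (L : U →L[ℝ] lp (fun _ : ι => W) ∞) (c : lp (fun _ : ι => W) ∞) {E : U → ℝ}
    (hE : ∀ w, E w = M (superpose v hv.continuous (L w + c))) :
    ContDiff ℝ 2 E ∧ ∀ x a b, fderiv ℝ (fderiv ℝ E) x a b =
      M (applyBounded ι W ℝ (applyBounded ι W (W →L[ℝ] ℝ)
        (superpose (fderiv ℝ (fderiv ℝ v)) hv₂ (L x + c)) (L a)) (L b)) := by
  obtain rfl : E = fun w => M (superpose v hv.continuous (L w + c)) := funext hE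
  have hv' : ContDiff ℝ 1 (fderiv ℝ v) := hv.fderiv_right le_rfl
  have hF : ∀ w, HasFDerivAt (fun w => L w + c) L w := fun w => L.hasFDerivAt.add_const c
  constructor
  · exact M.contDiff.comp ((contDiff_superpose 2 v hv).comp (L.contDiff.add contDiff_const))
  intro x a b
  -- `Φ` is continuous and linear, and `E'` is `Φ` applied to superposition by `v'`. Thus `E'` has
  -- the same form as `E` and the same differentiation rule applies again.
  obtain ⟨Φ, hΦ⟩ : ∃ Φ : lp (fun _ : ι => W →L[ℝ] ℝ) ∞ →L[ℝ] (U →L[ℝ] ℝ),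
      ∀ T, Φ T = M ∘L (applyBounded ι W ℝ T ∘L L) :=
    ⟨(ContinuousLinearMap.compL ℝ U (lp (fun _ : ι => W) ∞) ℝ).flip L ∘L
      (ContinuousLinearMap.compL ℝ (lp (fun _ : ι => W) ∞) (lp (fun _ : ι => ℝ) ∞) ℝ M ∘L
        applyBounded ι W ℝ), fun _ => rfl⟩
  have h1 : fderiv ℝ (fun w => M (superpose v hv.continuous (L w + c))) =
      fun w => Φ (superpose (fderiv ℝ v) hv'.continuous (L w + c)) := by
    funext w
    have h := hasFDerivAt_superpose v _ hv'.continuous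
      (fun x => (hv.differentiable two_ne_zero x).hasFDerivAt) hv.continuous (L w + c)
    rw [hΦ]
    exact (M.hasFDerivAt.comp w (h.comp w (hF w))).fderiv
  have h := hasFDerivAt_superpose (fderiv ℝ v) _ hv₂
    (fun x => (hv'.differentiable one_ne_zero x).hasFDerivAt) hv'.continuous (L x + c)
  have h2 : HasFDerivAt (fun w => Φ (superpose (fderiv ℝ v) hv'.continuous (L w + c)))
      (Φ ∘L (applyBounded ι W (W →L[ℝ] ℝ) (superpose (fderiv ℝ (fderiv ℝ v)) hv₂ (L x + c)) ∘L L))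
      x := by
    have h' := h.comp x (hF x)
    exact Φ.hasFDerivAt.comp x h'
  rw [h1, h2.fderiv, ContinuousLinearMap.comp_apply, ContinuousLinearMap.comp_apply, hΦ,
    ContinuousLinearMap.comp_apply, ContinuousLinearMap.comp_apply]

/-! ### The energy as a smooth functional of relative displacements -/

namespace ObjectiveStructure

variable {d₁ d₂ : ℕ} (X : ObjectiveStructure d₁ d₂)

/-- `v` is `V(y₀ + ·)` evaluated on extensions by zero of `y - y₀`, which are bounded although `y₀`
need not be. Coordinates outside the range do not matter, and the base point `y₀` lets the chain
rule carry `V'(y₀) = 0` over to `v`. -/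
theorem IsFiniteRangePotential.exists_finite_dimensional {X : ObjectiveStructure d₁ d₂}
    {V : (X.Off → Amb d₁ d₂) → ℝ} (hV : X.IsFiniteRangePotential V) :
    ∃ (RV : Finset X.Off) (v : (RV → Amb d₁ d₂) → ℝ), ContDiff ℝ 2 v ∧
      (∀ y, V y = v fun h => y h) ∧
      (∀ (A : Ort (Fin d₁ ⊕ Fin d₂)) (y : RV → Amb d₁ d₂), v (fun h => A (y h)) = v y) ∧
      (X.siteDeriv V = 0 → fderiv ℝ v (fun h => X.y₀ h) = 0) := by
  classical
  obtain ⟨RV, hfin, hRV⟩ := hV.finite_range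
  lift RV to Finset X.Off using hfin
  let e : (RV → Amb d₁ d₂) →ₗ[ℝ] lp (fun _ : X.Off => Amb d₁ d₂) ∞ :=
    { toFun := fun y => ⟨fun g => if h : g ∈ RV then y ⟨g, h⟩ else 0, memℓp_infty ⟨‖y‖, by
        rintro _ ⟨g, rfl⟩
        dsimp only
        split_ifs with h
        · exact norm_le_pi_norm y ⟨g, h⟩
        · simp⟩⟩
      map_add' := fun y y' => by
        ext1
        funext g
        change (if h : g ∈ RV then y ⟨g, h⟩ + y' ⟨g, h⟩ else 0) =
          (if h : g ∈ RV then y ⟨g, h⟩ else 0) + if h : g ∈ RV then y' ⟨g, h⟩ else 0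
        split_ifs
        · rfl
        · rw [add_zero]
      map_smul' := fun c y => by
        ext1
        funext g
        by_cases h : g ∈ RV
        · simp [h]
        · simp [h] }
  have he : ∀ y (g : RV), e y g = y g := fun y g => dif_pos g.2
  set ec := LinearMap.toContinuousLinearMap e with hec
  set z₀ : RV → Amb d₁ d₂ := fun h => X.y₀ h with hz₀
  have hres : ∀ y y' : X.Off → Amb d₁ d₂, (∀ h : RV, y h = y' h) → V y = V y' := by
    intro y y' h
    rw [hRV y, hRV y']
    congr 1
    funext g
    by_cases hg : g ∈ RV
    · simpa [hg] using h ⟨g, hg⟩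
    · simp [hg]
  have hv : ∀ y, V y = X.shifted V X.y₀ (ec ((fun h : RV => y h) - z₀)) := by
    intro y
    refine hres _ _ fun h => ?_
    change y h = X.y₀ h + e ((fun h : RV => y h) - z₀) h
    rw [he]
    simp [hz₀]
  have hsub : ∀ y : RV → Amb d₁ d₂,
      HasFDerivAt (fun y : RV → Amb d₁ d₂ => ec (y - z₀)) ec y := fun y => by
    have := ec.hasFDerivAt.comp y ((hasFDerivAt_id y).sub_const z₀)
    rwa [ContinuousLinearMap.comp_id] at this
  refine ⟨RV, fun y => X.shifted V X.y₀ (ec (y - z₀)), ?_, hv, ?_, ?_⟩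
  · exact (hV.smooth X.y₀).comp (ec.contDiff.comp (contDiff_id.sub contDiff_const))
  · intro A y
    have h1 := hv fun g => A (e y g)
    have h2 := hv (e y)
    simp only [he] at h1 h2
    exact h1.symm.trans ((hV.rotation A _).trans h2)
  · intro h0
    have h1 : HasFDerivAt (X.shifted V X.y₀) (X.siteDeriv V) (ec (z₀ - z₀)) := by
      rw [sub_self, map_zero]
      exact ((hV.smooth X.y₀).differentiable two_ne_zero 0).hasFDerivAt
    have h2 := (h1.comp z₀ (hsub z₀)).fderiv
    rw [h0, ContinuousLinearMap.zero_comp] at h2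
    exact h2

/-- Normality enters through `g t h = g h (h⁻¹ t h)`. -/
theorem IsPeriodicWith.comp_shift {X : ObjectiveStructure d₁ d₂} {α : Type} {N : ℕ} (hN : N ∈ X.M₀)
    {u : X.G → α} (hu : X.IsPeriodicWith N u) : X.IsPeriodicWith N fun g h => u (g * h) := by
  obtain ⟨-, H, hn, hH⟩ := hN
  intro g t ht
  funext h
  have h1 : h⁻¹ * t * h ∈ powSet X.T N := by
    rw [← hH] at ht ⊢
    simpa using hn.conj_mem t ht h⁻¹
  have := hu (g * h) _ h1
  simpa [mul_assoc] using this

theorem IsPeriodicWith.comp {X : ObjectiveStructure d₁ d₂} {α β : Type} {N : ℕ}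
    {u : X.G → α} (hu : X.IsPeriodicWith N u) (φ : α → β) : X.IsPeriodicWith N fun g => φ (u g) :=
  fun g t ht => congrArg φ (hu g t ht)

theorem period_spec (u : X.Uper) : X.period u ∈ X.M₀ ∧ X.IsPeriodicWith (X.period u) (X.val u) :=
  Nat.sInf_mem (s := {N | N ∈ X.M₀ ∧ X.IsPeriodicWith N (X.val u)}) u.2

theorem norm_val_le (u : X.Uper) (g : X.G) : ‖X.val u g‖ ≤ ‖u‖ :=
  lp.norm_apply_le_norm ENNReal.top_ne_zero u.1 g

/-- The relative displacements `rot(h) u(gh) - u(g)`, `h ∈ RV`, as a function of `g`. -/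
noncomputable def relDisp (RV : Finset X.Off) :
    X.Uper →L[ℝ] lp (fun _ : X.G => RV → Amb d₁ d₂) ∞ :=
  have key : ∀ (u : X.Uper) (g : X.G),
      ‖fun h : RV => X.lin h.1 (X.val u (g * h.1)) - X.val u g‖ ≤ 2 * ‖u‖ := fun u g => by
    refine (pi_norm_le_iff_of_nonneg (by positivity)).2 fun h => (norm_sub_le _ _).trans ?_
    rw [LinearIsometryEquiv.norm_map, two_mul]
    exact add_le_add (X.norm_val_le _ _) (X.norm_val_le _ _)
  LinearMap.mkContinuous
    { toFun := fun u => ⟨fun g h => X.lin h.1 (X.val u (g * h.1)) - X.val u g,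
        memℓp_infty ⟨2 * ‖u‖, by
          rintro _ ⟨g, rfl⟩
          exact key u g⟩⟩
      map_add' := fun u u' => by
        ext1
        funext g h
        change X.lin h.1 (X.val u (g * h.1) + X.val u' (g * h.1)) - (X.val u g + X.val u' g) =
          (X.lin h.1 (X.val u (g * h.1)) - X.val u g) +
            (X.lin h.1 (X.val u' (g * h.1)) - X.val u' g)
        rw [map_add]
        abel
      map_smul' := fun c u => by
        ext1
        funext g h
        change X.lin h.1 (c • X.val u (g * h.1)) - c • X.val u g =
          c • (X.lin h.1 (X.val u (g * h.1)) - X.val u g)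
        rw [map_smul, smul_sub] }
    2 fun u => lp.norm_le_of_forall_le (by positivity) (key u)

theorem relDisp_apply (RV : Finset X.Off) (u : X.Uper) (g : X.G) (h : RV) :
    X.relDisp RV u g h = X.lin h.1 (X.val u (g * h.1)) - X.val u g := rfl

theorem relDisp_periodic (RV : Finset X.Off) {u : X.Uper} {N : ℕ} (hN : N ∈ X.M₀)
    (hu : X.IsPeriodicWith N (X.val u)) : X.IsPeriodicWith N (X.relDisp RV u) := by
  intro g t ht
  funext h
  have h1 : X.val u (g * h.1) = X.val u (g * t * h.1) :=
    congrFun (hu.comp_shift hN g t ht) h.1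
  rw [relDisp_apply, relDisp_apply, hu g t ht, h1]

/-- The bounded family that is constantly equal to `(h · 0)_{h ∈ RV}`. -/
noncomputable def originShift (RV : Finset X.Off) : lp (fun _ : X.G => RV → Amb d₁ d₂) ∞ :=
  ⟨fun _ h => X.act h.1 0, memℓp_infty ⟨‖fun h : RV => X.act h.1 0‖, by
    rintro _ ⟨g, rfl⟩
    exact le_rfl⟩⟩

theorem relDisp_add_originShift (RV : Finset X.Off) (w : X.Uper) (g : X.G) (h : RV) :
    (X.relDisp RV w + X.originShift RV) g h = X.act h.1 (X.val w (g * h.1)) - X.val w g := by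
  change (X.lin h.1 (X.val w (g * h.1)) - X.val w g) + X.act h.1 0 = _
  have := X.act_sub h.1 (X.val w (g * h.1)) 0
  rw [sub_zero] at this
  rw [← this]
  abel

theorem relDisp_add_originShift_periodic (RV : Finset X.Off) {w : X.Uper} {N : ℕ}
    (hN : N ∈ X.M₀) (hw : X.IsPeriodicWith N (X.val w)) :
    X.IsPeriodicWith N (X.relDisp RV w + X.originShift RV) := fun g t ht =>
  congrArg (fun z : RV → Amb d₁ d₂ => z + fun h : RV => X.act h.1 0)
    (X.relDisp_periodic RV hN hw g t ht)

theorem relDisp_const (RV : Finset X.Off) (g : X.G) :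
    (X.relDisp RV (X.const X.x₀) + X.originShift RV) g = fun h : RV => X.y₀ h :=
  funext fun h => X.relDisp_add_originShift RV _ g h

/-- Invariance under `rot(g)⁻¹` replaces `(gh) · w(gh) - g · w(g)` by `h · w(gh) - w(g)`, which is
affine in `w` with coefficients independent of `g`. -/
theorem energy_eq_avg {X : ObjectiveStructure d₁ d₂} (C : ℕ → Set X.G)
    {V : (X.Off → Amb d₁ d₂) → ℝ}
    (hrot : ∀ (A : Ort (Fin d₁ ⊕ Fin d₂)) (y : X.Off → Amb d₁ d₂), V (fun g => A (y g)) = V y)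
    (RV : Finset X.Off) {v : (RV → Amb d₁ d₂) → ℝ} (hVv : ∀ y, V y = v fun h => y h)
    (w : X.Uper) :
    X.energy C V w =
      X.avg C (X.period w) fun g => v ((X.relDisp RV w + X.originShift RV) g) := by
  rw [energy]
  congr 1
  funext g
  rw [← hrot (X.lin g⁻¹), hVv]
  congr 1
  funext h
  rw [relDisp_add_originShift, act_mul, act_sub, ← lin_mul, inv_mul_cancel, lin_one]

set_option maxHeartbeats 2000000 in
theorem energy_contDiff_and_hessian {X : ObjectiveStructure d₁ d₂} {C : ℕ → Set X.G}
    (hC : X.IsRepSystem C) {V : (X.Off → Amb d₁ d₂) → ℝ}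
    (hrot : ∀ (A : Ort (Fin d₁ ⊕ Fin d₂)) (y : X.Off → Amb d₁ d₂), V (fun g => A (y g)) = V y)
    (RV : Finset X.Off) {v : (RV → Amb d₁ d₂) → ℝ} (hv : ContDiff ℝ 2 v)
    (hVv : ∀ y, V y = v fun h => y h) :
    ContDiff ℝ 2 (X.energy C V) ∧ ∀ (u u' : X.Uper) (N : ℕ), N ∈ X.M₀ →
      X.IsPeriodicWith N (X.val u) → X.IsPeriodicWith N (X.val u') →
      X.hessian C V u u' = X.avg C N fun g =>
        fderiv ℝ (fderiv ℝ v) (fun h => X.y₀ h) (X.relDisp RV u g) (X.relDisp RV u' g) := by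
  obtain ⟨M, hM⟩ := hC.exists_mean
  have hE : ∀ w, X.energy C V w =
      M (superpose v hv.continuous (X.relDisp RV w + X.originShift RV)) := by
    intro w
    obtain ⟨hN, hw⟩ := X.period_spec w
    rw [energy_eq_avg C hrot RV hVv w]
    exact (hM (superpose v hv.continuous (X.relDisp RV w + X.originShift RV)) _ hN
      ((X.relDisp_add_originShift_periodic RV hN hw).comp v)).symm
  have hv₂ : Continuous (fderiv ℝ (fderiv ℝ v)) :=
    (hv.fderiv_right (m := 1) le_rfl).continuous_fderiv one_ne_zero
  obtain ⟨h1, h2⟩ := contDiff_two_and_fderiv_fderiv_superpose M hv hv₂ _ _ hE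
  refine ⟨h1, fun u u' N hN hu hu' => ?_⟩
  rw [hessian, h2]
  have key : ∀ g, applyBounded X.G (RV → Amb d₁ d₂) ℝ (applyBounded X.G (RV → Amb d₁ d₂)
      ((RV → Amb d₁ d₂) →L[ℝ] ℝ) (superpose (fderiv ℝ (fderiv ℝ v)) hv₂
        (X.relDisp RV (X.const X.x₀) + X.originShift RV)) (X.relDisp RV u)) (X.relDisp RV u') g =
      fderiv ℝ (fderiv ℝ v) (fun h => X.y₀ h) (X.relDisp RV u g) (X.relDisp RV u' g) := fun g =>
    congrArg (fun z => fderiv ℝ (fderiv ℝ v) z (X.relDisp RV u g) (X.relDisp RV u' g))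
      (X.relDisp_const RV g)
  have hper := fun g t ht => (key g).trans <| .trans (by
    rw [X.relDisp_periodic RV hN hu g t ht, X.relDisp_periodic RV hN hu' g t ht])
    (key (g * t)).symm
  rw [hM _ N hN hper]
  exact congrArg (X.avg C N) (funext key)

end ObjectiveStructure

/-! ### Infinitesimal rotations -/

/-- By invariance every rotated copy of the critical point `y` is critical. The curve `exp(tS) y`
stays among these copies and has velocity `S y` at `t = 0`, so differentiating `v' = 0` along it
gives the claim. -/
theorem fderiv_fderiv_apply_skewAdjoint {ι F : Type} [Fintype ι] [NormedAddCommGroup F]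
    [InnerProductSpace ℝ F] [CompleteSpace F] {v : (ι → F) → ℝ} (hv : ContDiff ℝ 2 v)
    (hrot : ∀ (A : F ≃ₗᵢ[ℝ] F) (y : ι → F), v (fun i => A (y i)) = v y) {y : ι → F}
    (hy : fderiv ℝ v y = 0) {S : F →L[ℝ] F} (hS : S ∈ skewAdjoint (F →L[ℝ] F)) :
    fderiv ℝ (fderiv ℝ v) y (fun i => S (y i)) = 0 := by
  let _ : NormedAlgebra ℚ (F →L[ℝ] F) := NormedAlgebra.restrictScalars ℚ ℝ _
  have hmem : ∀ t : ℝ, NormedSpace.exp (t • S) ∈ unitary (F →L[ℝ] F) := fun t =>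
    NormedSpace.exp_mem_unitary_of_mem_skewAdjoint (skewAdjoint.smul_mem t hS)
  have hzero : ∀ A : F ≃ₗᵢ[ℝ] F, fderiv ℝ v (fun i => A (y i)) = 0 := by
    intro A
    set B : (ι → F) ≃L[ℝ] (ι → F) :=
      ContinuousLinearEquiv.piCongrRight fun _ => A.toContinuousLinearEquiv with hB
    have h1 : v ∘ B = v := funext fun z => hrot A z
    have h2 := B.comp_right_fderiv (f := v) (x := y)
    rw [h1, hy] at h2
    ext z
    have h3 := DFunLike.congr_fun h2 (B.symm z)
    change fderiv ℝ v (B y) z = 0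
    simpa using h3.symm
  have hcurve : ∀ t : ℝ, fderiv ℝ v (fun i => NormedSpace.exp (t • S) (y i)) = 0 := fun t =>
    hzero (Unitary.linearIsometryEquiv ⟨_, hmem t⟩)
  set γ : ℝ → ι → F := fun t i => NormedSpace.exp (t • S) (y i) with hγ_def
  have hγ : HasDerivAt γ (fun i => S (y i)) 0 := by
    rw [hasDerivAt_pi]
    intro i
    have h := hasDerivAt_exp_smul_const (𝕂 := ℝ) S 0
    rw [zero_smul, NormedSpace.exp_zero, one_mul] at h
    simpa using h.clm_apply (hasDerivAt_const (0 : ℝ) (y i))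
  have hγ0 : γ 0 = y := by
    funext i
    simp [hγ_def]
  have hv' : HasFDerivAt (fderiv ℝ v) (fderiv ℝ (fderiv ℝ v) y) (γ 0) := by
    rw [hγ0]
    exact ((hv.fderiv_right (m := 1) le_rfl).differentiable one_ne_zero y).hasFDerivAt
  have h : HasDerivAt (fderiv ℝ v ∘ γ) (fderiv ℝ (fderiv ℝ v) y fun i => S (y i)) 0 :=
    HasFDerivAt.comp_hasDerivAt (E := (ι → F) →L[ℝ] ℝ) (F := ι → F) (0 : ℝ) hv' hγ
  have h0 : fderiv ℝ v ∘ γ = fun _ => 0 := funext hcurve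
  rw [h0] at h
  exact HasDerivAt.unique (𝕜 := ℝ) (F := (ι → F) →L[ℝ] ℝ) h
    (hasDerivAt_const (𝕜 := ℝ) (F := (ι → F) →L[ℝ] ℝ) 0 0)

theorem toEuclideanCLM_mem_skewAdjoint {d₁ d₂ : ℕ}
    {S : Matrix (Fin d₁ ⊕ Fin d₂) (Fin d₁ ⊕ Fin d₂) ℝ}
    (hS : S ∈ ObjectiveStructure.skew d₁ d₂) :
    Matrix.toEuclideanCLM (𝕜 := ℝ) S ∈ skewAdjoint (Amb d₁ d₂ →L[ℝ] Amb d₁ d₂) := by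
  have hS' : Sᵀ = -S := hS
  rw [skewAdjoint.mem_iff, ← map_star, Matrix.star_eq_conjTranspose,
    Matrix.conjTranspose_eq_transpose_of_trivial, hS', map_neg]

theorem inner_toEuclideanLin_self_of_skew {d₁ d₂ : ℕ}
    {S : Matrix (Fin d₁ ⊕ Fin d₂) (Fin d₁ ⊕ Fin d₂) ℝ}
    (hS : S ∈ ObjectiveStructure.skew d₁ d₂) (z : Amb d₁ d₂) :
    inner ℝ (Matrix.toEuclideanLin S z) z = 0 := by
  have h := toEuclideanCLM_mem_skewAdjoint hS
  rw [skewAdjoint.mem_iff, ContinuousLinearMap.star_eq_adjoint] at h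
  have h1 := ContinuousLinearMap.adjoint_inner_left (Matrix.toEuclideanCLM (𝕜 := ℝ) S) z z
  rw [h, neg_apply, inner_neg_left, real_inner_comm] at h1
  have h2 : inner ℝ (Matrix.toEuclideanCLM (𝕜 := ℝ) S z) z = 0 := by
    rw [real_inner_comm]
    linarith
  exact h2

namespace ObjectiveStructure

variable {d₁ d₂ : ℕ} (X : ObjectiveStructure d₁ d₂)

/-! ### Propagation of local rigid approximations -/

/-- A function `u` on `𝒢` together with affine maps `A g` that approximate `u(g ·)` on `R` up to
errors `e g`. -/
structure RigidApprox (R : Finset X.G) where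
  u : X.G → Amb d₁ d₂
  e : X.G → ℝ
  A : X.G → Amb d₁ d₂ →ᵃ[ℝ] Amb d₁ d₂
  e_nonneg : ∀ g, 0 ≤ e g
  approx : ∀ g, ∀ r ∈ R, ‖X.lin r (u (g * r)) - A g (X.act r X.x₀)‖ ≤ e g

variable {X} {R : Finset X.G}

/-- A quantity is controlled by the errors of a rigid approximation at finitely many shifts. -/
def ErrorBounded (q : X.RigidApprox R → X.G → ℝ) : Prop :=
  ∃ C : ℝ, 0 ≤ C ∧ ∃ F : Finset X.G, ∀ D g, q D g ≤ C * ∑ s ∈ F, D.e (g * s)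

namespace ErrorBounded

variable {q q' : X.RigidApprox R → X.G → ℝ}

theorem mono (h : ErrorBounded q') (hq : ∀ D g, q D g ≤ q' D g) : ErrorBounded q := by
  obtain ⟨C, hC, F, hF⟩ := h
  exact ⟨C, hC, F, fun D g => (hq D g).trans (hF D g)⟩

theorem error : ErrorBounded fun (D : X.RigidApprox R) g => D.e g :=
  ⟨1, zero_le_one, {1}, fun D g => by simp⟩

theorem zero : ErrorBounded fun (_ : X.RigidApprox R) _ => 0 :=
  ⟨0, le_rfl, ∅, fun D g => by simp⟩

theorem add (h : ErrorBounded q) (h' : ErrorBounded q') :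
    ErrorBounded fun D g => q D g + q' D g := by
  classical
  obtain ⟨C, hC, F, hF⟩ := h
  obtain ⟨C', hC', F', hF'⟩ := h'
  refine ⟨C + C', by positivity, F ∪ F', fun D g => ?_⟩
  rw [add_mul]
  refine add_le_add ((hF D g).trans ?_) ((hF' D g).trans ?_)
  · exact mul_le_mul_of_nonneg_left (Finset.sum_le_sum_of_subset_of_nonneg
      Finset.subset_union_left fun s _ _ => D.e_nonneg _) hC
  · exact mul_le_mul_of_nonneg_left (Finset.sum_le_sum_of_subset_of_nonneg
      Finset.subset_union_right fun s _ _ => D.e_nonneg _) hC'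

theorem const_mul (h : ErrorBounded q) {c : ℝ} (hc : 0 ≤ c) :
    ErrorBounded fun D g => c * q D g := by
  obtain ⟨C, hC, F, hF⟩ := h
  refine ⟨c * C, by positivity, F, fun D g => ?_⟩
  rw [mul_assoc]
  exact mul_le_mul_of_nonneg_left (hF D g) hc

theorem shift (h : ErrorBounded q) (k : X.G) : ErrorBounded fun D g => q D (g * k) := by
  classical
  obtain ⟨C, hC, F, hF⟩ := h
  refine ⟨C, hC, F.image (k * ·), fun D g => (hF D (g * k)).trans_eq ?_⟩
  rw [Finset.sum_image fun a _ b _ hab => mul_left_cancel hab]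
  simp only [mul_assoc]

theorem sum {κ : Type} (s : Finset κ) {f : κ → X.RigidApprox R → X.G → ℝ}
    (h : ∀ i ∈ s, ErrorBounded (f i)) : ErrorBounded fun D g => ∑ i ∈ s, f i D g := by
  classical
  induction s using Finset.induction_on with
  | empty => simpa using zero
  | insert i s hi ih =>
    simp only [Finset.sum_insert hi]
    exact (h i (Finset.mem_insert_self i s)).add
      (ih fun j hj => h j (Finset.mem_insert_of_mem hj))

end ErrorBounded

namespace RigidApprox

/-- The mismatch between the rigid approximations at `g h` and at `g`. -/
noncomputable def mismatch (D : X.RigidApprox R) (h g : X.G) : Amb d₁ d₂ →ᵃ[ℝ] Amb d₁ d₂ :=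
  (X.lin h).toLinearEquiv.toLinearMap.toAffineMap.comp (D.A (g * h)) -
    (D.A g).comp (oplus (h : Ort (Fin d₁) × Euc (Fin d₂))).toAffineEquiv.toAffineMap

theorem mismatch_apply (D : X.RigidApprox R) (h g : X.G) (x : Amb d₁ d₂) :
    D.mismatch h g x = X.lin h (D.A (g * h) x) - D.A g (X.act h x) := rfl

/-- For `b ∈ R''` both `b` and `rb` lie in `R`, so the approximations at `gr` and at `g` both see
the value `u(grb)`. This bounds the mismatch at `b · x₀` by `e(gr) + e(g)`. The mismatch is affine,
so the bound spreads over the affine span with a constant depending on the point. -/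
theorem errorBounded_mismatch_generator {r : X.G} {R'' : Set X.G} (h1 : ∀ b ∈ R'', b ∈ R)
    (hr : ∀ b ∈ R'', r * b ∈ R) {x : Amb d₁ d₂}
    (hx : x ∈ affineSpan ℝ ((fun g => X.act g X.x₀) '' R'')) :
    ErrorBounded fun (D : X.RigidApprox R) g => ‖D.mismatch r g x‖ := by
  refine affineSpan_induction hx ?_ ?_
  · rintro _ ⟨b, hb, rfl⟩
    refine ((ErrorBounded.error.shift r).add ErrorBounded.error).mono fun D g => ?_
    have e1 := D.approx (g * r) b (h1 b hb)
    have e2 := D.approx g (r * b) (hr b hb)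
    rw [← (X.lin r).norm_map, map_sub] at e1
    rw [lin_mul, act_mul, ← mul_assoc] at e2
    rw [mismatch_apply]
    have h3 := norm_sub_le_norm_sub_add_norm_sub (X.lin r (D.A (g * r) (X.act b X.x₀)))
      (X.lin r (X.lin b (D.u (g * r * b)))) (D.A g (X.act r (X.act b X.x₀)))
    rw [norm_sub_rev] at e1
    exact h3.trans (add_le_add e1 e2)
  · intro c p₁ p₂ p₃ q₁ q₂ q₃
    refine (((q₁.add q₂).const_mul (abs_nonneg c)).add q₃).mono fun D g => ?_
    rw [AffineMap.map_vadd, map_smul, AffineMap.linearMap_vsub]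
    refine (norm_add_le _ _).trans (add_le_add ?_ le_rfl)
    rw [norm_smul, Real.norm_eq_abs]
    exact mul_le_mul_of_nonneg_left (norm_sub_le _ _) (abs_nonneg c)

/-- The mismatch is a cocycle: that of `ab` at `g` is that of `a` at `g`, evaluated after `b`, plus
`rot(a)` times that of `b` at `ga`. Hence bounds pass from generators to products and inverses. The
evaluation point moves along the orbit, so the induction needs all `k`, and generators need the full
affine hull. -/
theorem errorBounded_mismatch (hR : X.Property2 (R : Set X.G)) (h k : X.G) :
    ErrorBounded fun (D : X.RigidApprox R) g => ‖D.mismatch h g (X.act k X.x₀)‖ := by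
  obtain ⟨-, R', R'', h1, hgen, ⟨-, -, haff⟩, hmul⟩ := hR
  have hh : h ∈ Subgroup.closure R' := hgen ▸ Subgroup.mem_top h
  induction hh using Subgroup.closure_induction generalizing k with
  | mem r hr =>
    refine errorBounded_mismatch_generator (R'' := R'') (fun b hb => ?_)
      (fun b hb => hmul r hr b hb) ?_
    · simpa using hmul 1 h1 b hb
    · rw [haff]
      exact subset_affineSpan ℝ _ ⟨k, rfl⟩
  | one =>
    refine ErrorBounded.zero.mono fun D g => ?_
    simp [mismatch_apply]
  | mul a b _ _ iha ihb =>
    refine ((iha (b * k)).add ((ihb k).shift a)).mono fun D g => ?_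
    have e : D.mismatch (a * b) g (X.act k X.x₀) = D.mismatch a g (X.act (b * k) X.x₀) +
        X.lin a (D.mismatch b (g * a) (X.act k X.x₀)) := by
      simp only [mismatch_apply, lin_mul, act_mul, map_sub, mul_assoc]
      abel
    rw [e]
    refine (norm_add_le _ _).trans_eq ?_
    rw [LinearIsometryEquiv.norm_map]
  | inv a _ iha =>
    refine ((iha (a⁻¹ * k)).shift a⁻¹).mono fun D g => ?_
    have e : D.mismatch a⁻¹ g (X.act k X.x₀) =
        -X.lin a⁻¹ (D.mismatch a (g * a⁻¹) (X.act (a⁻¹ * k) X.x₀)) := by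
      simp only [mismatch_apply, map_sub, ← lin_mul, ← act_mul, mul_inv_cancel_left,
        inv_mul_cancel, inv_mul_cancel_right, lin_one]
      abel
    rw [e, norm_neg, LinearIsometryEquiv.norm_map]

theorem one_mem (hR : X.Property2 (R : Set X.G)) : 1 ∈ R := by
  obtain ⟨-, R', R'', h1, -, ⟨-, h1', -⟩, hmul⟩ := hR
  simpa using hmul 1 h1 1 h1'

/-- The approximation at `gh` is accurate at `id ∈ R`, and the mismatch transfers it to the one at
`g`. So `A g` predicts `u(gh)` even for `h` outside `R`. -/
theorem errorBounded_sub (hR : X.Property2 (R : Set X.G)) (h : X.G) :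
    ErrorBounded fun (D : X.RigidApprox R) g =>
      ‖X.lin h (D.u (g * h)) - D.A g (X.act h X.x₀)‖ := by
  refine ((ErrorBounded.error.shift h).add (errorBounded_mismatch hR h 1)).mono fun D g => ?_
  have e1 := D.approx (g * h) 1 (one_mem hR)
  rw [← (X.lin h).norm_map, map_sub, lin_one, act_one, mul_one] at e1
  rw [act_one, mismatch_apply]
  exact (norm_sub_le_norm_sub_add_norm_sub _ _ _).trans (add_le_add e1 le_rfl)

/-- Subtracting the estimate at `id` cancels the translation part of `A g`; only its linear part
remains. -/
theorem exists_sum_bound (hR : X.Property2 (R : Set X.G)) (RV : Finset X.Off) :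
    ErrorBounded fun (D : X.RigidApprox R) g =>
      ‖fun h : RV => X.lin h.1 (D.u (g * h.1)) - D.u g -
        (D.A g (X.act h.1 X.x₀) - D.A g X.x₀)‖ := by
  refine (ErrorBounded.sum (Finset.univ : Finset RV) fun h _ =>
    (errorBounded_sub hR h.1.1).add ErrorBounded.error).mono fun D g => ?_
  have hpos : ∀ h : RV, 0 ≤ ‖X.lin h.1 (D.u (g * h.1)) - D.A g (X.act h.1 X.x₀)‖ + D.e g :=
    fun h => add_nonneg (norm_nonneg _) (D.e_nonneg g)
  refine (pi_norm_le_iff_of_nonneg (Finset.sum_nonneg fun h _ => hpos h)).2 fun h => ?_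
  refine le_trans ?_ (Finset.single_le_sum (fun h _ => hpos h) (Finset.mem_univ h))
  have e1 := D.approx g 1 (one_mem hR)
  rw [lin_one, act_one, mul_one] at e1
  rw [sub_sub_sub_comm]
  exact (norm_sub_le _ _).trans (add_le_add le_rfl e1)

end RigidApprox

end ObjectiveStructure

namespace ObjectiveStructure

variable {d₁ d₂ : ℕ} {X : ObjectiveStructure d₁ d₂} {C : ℕ → Set X.G} {R : Finset X.G}

/-! ### Seminorms -/

variable (X) in
/-- The distance of `u(g ·)|_R` to the space `U_iso(R)` with linear components in `𝔰`. -/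
noncomputable def isoDist (𝔰 : Submodule ℝ (Matrix (Fin d₁ ⊕ Fin d₂) (Fin d₁ ⊕ Fin d₂) ℝ))
    (R : Finset X.G) (u : X.Uper) (g : X.G) : ℝ :=
  ‖(X.Uiso 𝔰 R)ᗮ.starProjection (WithLp.toLp 2 fun h : R => X.val u (g * h))‖

theorem isoDist_periodic (𝔰 : Submodule ℝ (Matrix (Fin d₁ ⊕ Fin d₂) (Fin d₁ ⊕ Fin d₂) ℝ))
    {u : X.Uper} {N : ℕ} (hN : N ∈ X.M₀) (hu : X.IsPeriodicWith N (X.val u)) :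
    X.IsPeriodicWith N (X.isoDist 𝔰 R u) :=
  (hu.comp_shift hN).comp fun w =>
    ‖(X.Uiso 𝔰 R)ᗮ.starProjection (WithLp.toLp 2 fun h : R => w h)‖

/-- Frees the seminorm from the least period, so that two functions can be averaged over a common
one. -/
theorem seminorm_eq (hC : X.IsRepSystem C)
    (𝔰 : Submodule ℝ (Matrix (Fin d₁ ⊕ Fin d₂) (Fin d₁ ⊕ Fin d₂) ℝ)) {u : X.Uper} {N : ℕ}
    (hN : N ∈ X.M₀) (hu : X.IsPeriodicWith N (X.val u)) :
    X.seminorm C 𝔰 R u = √(X.avg C N fun g => X.isoDist 𝔰 R u g ^ 2) := by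
  obtain ⟨hp, hpu⟩ := X.period_spec u
  rw [← hC.avg_eq_avg hp hN ((isoDist_periodic 𝔰 hp hpu).comp (· ^ 2))
    ((isoDist_periodic 𝔰 hN hu).comp (· ^ 2))]
  rfl

/-- The orthogonal projection of `u(g ·)|_R` to `U_iso(R)` has the form `rot(r)⁻¹(a + S(r · x₀ -
x₀))`; take `A g x = a + S(x - x₀)`. The norm of the residual bounds each of its coordinates. -/
theorem exists_rigidApprox
    {𝔰 : Submodule ℝ (Matrix (Fin d₁ ⊕ Fin d₂) (Fin d₁ ⊕ Fin d₂) ℝ)} (u : X.Uper) :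
    ∃ D : X.RigidApprox R, D.u = X.val u ∧ D.e = X.isoDist 𝔰 R u ∧
      ∀ g, ∃ S ∈ 𝔰, ∀ x y, D.A g x - D.A g y = Matrix.toEuclideanLin S (x - y) := by
  set f : X.G → X.FunR R := fun g => WithLp.toLp 2 fun h : R => X.val u (g * h) with hf
  have hmem : ∀ g, ∃ a : Amb d₁ d₂, ∃ S ∈ 𝔰, ∀ r : R,
      X.lin r ((X.Uiso 𝔰 R).starProjection (f g) r) =
        a + Matrix.toEuclideanLin S (X.act r X.x₀ - X.x₀) := by
    intro g
    obtain ⟨w, ⟨a, ha⟩, z, ⟨S, hS, hz⟩, hwz⟩ :=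
      Submodule.mem_sup.1 (Submodule.starProjection_apply_mem (X.Uiso 𝔰 R) (f g))
    refine ⟨a, S, hS, fun r => ?_⟩
    rw [← hwz, PiLp.add_apply, map_add, ha, hz]
  choose a S hS ha using hmem
  have hA : ∀ g x, (((Matrix.toEuclideanLin (S g)).toAffineMap.comp
      (AffineMap.id ℝ (Amb d₁ d₂) - AffineMap.const ℝ (Amb d₁ d₂) X.x₀)) +
        AffineMap.const ℝ (Amb d₁ d₂) (a g)) x =
      Matrix.toEuclideanLin (S g) (x - X.x₀) + a g := fun g x => rfl
  refine ⟨⟨X.val u, X.isoDist 𝔰 R u, fun g =>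
    ((Matrix.toEuclideanLin (S g)).toAffineMap.comp
      (AffineMap.id ℝ (Amb d₁ d₂) - AffineMap.const ℝ (Amb d₁ d₂) X.x₀)) +
        AffineMap.const ℝ (Amb d₁ d₂) (a g), fun g => norm_nonneg _, fun g r hr => ?_⟩,
    rfl, rfl, fun g => ⟨S g, hS g, fun x y => ?_⟩⟩
  · rw [hA, add_comm, ← ha g ⟨r, hr⟩, ← map_sub, LinearIsometryEquiv.norm_map]
    have hp : X.isoDist 𝔰 R u g = ‖f g - (X.Uiso 𝔰 R).starProjection (f g)‖ := by
      rw [isoDist, Submodule.starProjection_orthogonal]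
      rfl
    rw [hp]
    exact PiLp.norm_apply_le (f g - (X.Uiso 𝔰 R).starProjection (f g)) ⟨r, hr⟩
  · refine (congrArg₂ (· - ·) (hA g x) (hA g y)).trans ?_
    rw [add_sub_add_right_eq_sub, ← map_sub, sub_sub_sub_cancel_right]

theorem exists_relDisp_sub_skew_bound (hR : X.Property2 (R : Set X.G)) (RV : Finset X.Off) :
    ∃ B : ℝ, 0 ≤ B ∧ ∃ F : Finset X.G, ∀ (u : X.Uper) (g : X.G), ∃ S ∈ skew d₁ d₂,
      ‖X.relDisp RV u g - fun h : RV => Matrix.toEuclideanLin S (X.y₀ h)‖ ≤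
        B * ∑ s ∈ F, X.isoDist (skew d₁ d₂) R u (g * s) := by
  obtain ⟨B, hB, F, hF⟩ := RigidApprox.exists_sum_bound hR RV
  refine ⟨B, hB, F, fun u g => ?_⟩
  obtain ⟨D, hu, he, hA⟩ := exists_rigidApprox (R := R) (𝔰 := skew d₁ d₂) u
  obtain ⟨S, hS, hSA⟩ := hA g
  refine ⟨S, hS, ?_⟩
  have h := hF D g
  simp only [hSA, hu, he] at h
  exact h

/-! ### The bound on the second derivative -/

theorem abs_apply_le_of_apply_eq_zero {W : Type} [NormedAddCommGroup W] [NormedSpace ℝ W]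
    (b : W →L[ℝ] W →L[ℝ] ℝ) {x y x' y' : W} (hx : b x' = 0) (hy : ∀ z, b z y' = 0) {B r s : ℝ}
    (hxr : ‖x - x'‖ ≤ B * r) (hys : ‖y - y'‖ ≤ B * s) :
    |b x y| ≤ ‖b‖ * (B * B) * (r * s) := by
  have h : b x y = b (x - x') (y - y') := by
    rw [map_sub, map_sub, hx, sub_zero, hy, sub_zero]
  rw [h, ← Real.norm_eq_abs]
  calc _ ≤ ‖b‖ * ‖x - x'‖ * ‖y - y'‖ := b.le_opNorm₂ _ _
    _ = ‖b‖ * (‖x - x'‖ * ‖y - y'‖) := mul_assoc _ _ _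
    _ ≤ ‖b‖ * ((B * r) * (B * s)) := mul_le_mul_of_nonneg_left
        (mul_le_mul hxr hys (norm_nonneg _) ((norm_nonneg _).trans hxr)) (norm_nonneg b)
    _ = _ := by ring

/-- Cauchy–Schwarz handles each of the `F.card * F.card` products, and shift invariance of the
average removes `s` and `s'`. -/
theorem IsRepSystem.abs_avg_le_of_shifts (hC : X.IsRepSystem C) {N : ℕ} (hN : N ∈ X.M₀)
    {q e e' : X.G → ℝ} (he : X.IsPeriodicWith N e) (he' : X.IsPeriodicWith N e') {c : ℝ}
    (hc : 0 ≤ c) (F : Finset X.G)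
    (hq : ∀ g, |q g| ≤ c * ∑ s ∈ F, ∑ s' ∈ F, e (g * s) * e' (g * s')) :
    |X.avg C N q| ≤ c * (F.card * F.card) *
      (√(X.avg C N fun g => e g ^ 2) * √(X.avg C N fun g => e' g ^ 2)) := by
  set p := √(X.avg C N fun g => e g ^ 2) * √(X.avg C N fun g => e' g ^ 2) with hp
  have hss : ∀ s s', X.avg C N (fun g => e (g * s) * e' (g * s')) ≤ p := by
    intro s s'
    refine (hC.avg_mul_le hN (fun g => e (g * s)) fun g => e' (g * s')).trans_eq ?_
    rw [hC.avg_mul_right hN (he.comp (· ^ 2)) s, hC.avg_mul_right hN (he'.comp (· ^ 2)) s']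
  calc _ ≤ X.avg C N (fun g => |q g|) := hC.abs_avg_le hN _
    _ ≤ X.avg C N (fun g => c * ∑ s ∈ F, ∑ s' ∈ F, e (g * s) * e' (g * s')) :=
        hC.avg_mono hN hq
    _ = c * ∑ s ∈ F, ∑ s' ∈ F, X.avg C N (fun g => e (g * s) * e' (g * s')) := by
        rw [hC.avg_smul hN, hC.avg_sum hN]
        simp only [hC.avg_sum hN]
    _ ≤ c * ∑ s ∈ F, ∑ s' ∈ F, p := by
        gcongr with s _ s' _
        exact hss s s'
    _ = _ := by
        simp only [Finset.sum_const, nsmul_eq_mul]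
        ring

set_option maxHeartbeats 2000000 in
theorem hessian_bound (hC : X.IsRepSystem C) (hR : X.Property2 (R : Set X.G)) (RV : Finset X.Off)
    (b : (RV → Amb d₁ d₂) →L[ℝ] (RV → Amb d₁ d₂) →L[ℝ] ℝ)
    (hb : ∀ S ∈ skew d₁ d₂, b (fun h => Matrix.toEuclideanLin S (X.y₀ h)) = 0)
    (hb' : ∀ S ∈ skew d₁ d₂, ∀ z, b z (fun h => Matrix.toEuclideanLin S (X.y₀ h)) = 0) :
    ∃ K : ℝ, 0 < K ∧ ∀ (u u' : X.Uper) (N : ℕ), N ∈ X.M₀ →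
      X.IsPeriodicWith N (X.val u) → X.IsPeriodicWith N (X.val u') →
      |X.avg C N fun g => b (X.relDisp RV u g) (X.relDisp RV u' g)| ≤
        K * X.seminormR C R u * X.seminormR C R u' := by
  obtain ⟨B, hB, F, hF⟩ := exists_relDisp_sub_skew_bound hR RV
  -- The summand 1 only ensures that the constant is positive.
  refine ⟨‖b‖ * (B * B) * (F.card * F.card) + 1, by positivity, fun u u' N hN hu hu' => ?_⟩
  have hpt : ∀ g, |b (X.relDisp RV u g) (X.relDisp RV u' g)| ≤
      ‖b‖ * (B * B) * ∑ s ∈ F, ∑ s' ∈ F,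
        X.isoDist (skew d₁ d₂) R u (g * s) * X.isoDist (skew d₁ d₂) R u' (g * s') := by
    intro g
    obtain ⟨S, hS, h1⟩ := hF u g
    obtain ⟨S', hS', h2⟩ := hF u' g
    rw [← Finset.sum_mul_sum]
    exact abs_apply_le_of_apply_eq_zero (W := RV → Amb d₁ d₂) b (hb S hS) (hb' S' hS') h1 h2
  have h := hC.abs_avg_le_of_shifts hN (isoDist_periodic _ hN hu) (isoDist_periodic _ hN hu')
    (by positivity) F hpt
  rw [← seminorm_eq hC _ hN hu, ← seminorm_eq hC _ hN hu'] at h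
  refine h.trans ?_
  rw [mul_assoc (_ + 1 : ℝ), add_mul, one_mul]
  exact le_add_of_nonneg_right (mul_nonneg (Real.sqrt_nonneg _) (Real.sqrt_nonneg _))

theorem isoDist_antitone {𝔰 𝔰' : Submodule ℝ (Matrix (Fin d₁ ⊕ Fin d₂) (Fin d₁ ⊕ Fin d₂) ℝ)}
    (h : 𝔰 ≤ 𝔰') (u : X.Uper) (g : X.G) : X.isoDist 𝔰' R u g ≤ X.isoDist 𝔰 R u g := by
  have hle : (X.Uiso 𝔰' R)ᗮ ≤ (X.Uiso 𝔰 R)ᗮ := by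
    refine Submodule.orthogonal_le (sup_le_sup_left ?_ _)
    rintro w ⟨S, hS, hw⟩
    exact ⟨S, h hS, hw⟩
  rw [isoDist, isoDist, ← Submodule.starProjection_comp_starProjection_of_le hle]
  exact Submodule.norm_starProjection_apply_le _ _

theorem seminorm_antitone (hC : X.IsRepSystem C)
    {𝔰 𝔰' : Submodule ℝ (Matrix (Fin d₁ ⊕ Fin d₂) (Fin d₁ ⊕ Fin d₂) ℝ)} (h : 𝔰 ≤ 𝔰')
    (u : X.Uper) : X.seminorm C 𝔰' R u ≤ X.seminorm C 𝔰 R u := by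
  obtain ⟨hN, hu⟩ := X.period_spec u
  rw [seminorm_eq hC _ hN hu, seminorm_eq hC _ hN hu]
  exact Real.sqrt_le_sqrt (hC.avg_mono hN fun g =>
    pow_le_pow_left₀ (norm_nonneg _) (isoDist_antitone h u g) 2)

/-! ### A periodic function that is not locally rigid -/

/-- If `g = tᴺ` with `t ∈ 𝒯` for a large `N`, the translation of `t` is `1/N` times that of `g`, so
it vanishes by discreteness of `𝒮`. Then `t` is the one element of `𝒯` over the identity. -/
theorem exists_notMem_powSet {g : X.G} (hg : g ≠ 1) : ∃ N ∈ X.M₀, g ∉ powSet X.T N := by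
  by_contra! hcon
  obtain ⟨K, hK, hM⟩ := X.exists_period
  have hd := X.spaceGroup.1 0
  set O := Set.range fun s : X.G.map (MonoidHom.snd (Ort (Fin d₁)) (Euc (Fin d₂))) =>
    (s : Euc (Fin d₂)) 0 with hO
  have h0 : (0 : Vec (Fin d₂)) ∈ O := ⟨1, rfl⟩
  obtain ⟨ε, hε, hball⟩ := Metric.exists_ball_inter_eq_singleton_of_mem_discrete
    (isDiscrete_iff_discreteTopology.2 hd) h0
  set τ : Vec (Fin d₂) := (g : Ort (Fin d₁) × Euc (Fin d₂)).2 0 with hτ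
  obtain ⟨n, hn⟩ := exists_nat_gt (‖τ‖ / ε)
  have hn0 : (0 : ℝ) < n := lt_of_le_of_lt (by positivity) hn
  have hnN : 0 < n := by exact_mod_cast hn0
  set N := K * n with hNdef
  have hNpos : 0 < N := Nat.mul_pos hK hnN
  obtain ⟨t, ht, htg⟩ := hcon N (hM n hnN)
  have htt := (X.section_T.mapsTo ht).2
  have hpow : ∀ m : ℕ, ∀ t ∈ X.T, ((t ^ m : X.G) : Ort (Fin d₁) × Euc (Fin d₂)).2 0 =
      m • (t : Ort (Fin d₁) × Euc (Fin d₂)).2 0 := by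
    intro m t ht
    have h := translation_pow_apply (X.section_T.mapsTo ht).2 m 0
    rw [zero_add] at h
    exact h
  have hτN : τ = N • (t : Ort (Fin d₁) × Euc (Fin d₂)).2 0 := by
    rw [hτ, ← htg]
    exact hpow N t ht
  have hnorm : ‖τ‖ = N * ‖(t : Ort (Fin d₁) × Euc (Fin d₂)).2 0‖ := by
    rw [hτN, ← Nat.cast_smul_eq_nsmul ℝ, norm_smul, Real.norm_natCast]
  have hsmall : ‖(t : Ort (Fin d₁) × Euc (Fin d₂)).2 0‖ < ε := by
    rw [div_lt_iff₀ hε] at hn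
    have hnle : (n : ℝ) ≤ N := by
      exact_mod_cast Nat.le_mul_of_pos_left n hK
    by_contra! hle
    have : (n : ℝ) * ε ≤ N * ‖(t : Ort (Fin d₁) × Euc (Fin d₂)).2 0‖ := by gcongr
    linarith
  have ht0 : (t : Ort (Fin d₁) × Euc (Fin d₂)).2 0 = 0 := by
    have hm : (t : Ort (Fin d₁) × Euc (Fin d₂)).2 0 ∈ Metric.ball 0 ε ∩ O :=
      ⟨by simpa using hsmall, ⟨⟨_, ⟨_, t.2, rfl⟩⟩, rfl⟩⟩
    rw [hball] at hm
    exact hm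
  have honly : ∀ t' ∈ X.T, (t' : Ort (Fin d₁) × Euc (Fin d₂)).2 0 = 0 → t' = t := by
    intro t' ht' h'
    refine X.section_T.injOn ht' ht ?_
    have h1 := (X.section_T.mapsTo ht').2
    ext1 x
    rw [translation_apply h1, translation_apply htt, h', ht0]
  obtain ⟨H, -, hH⟩ := (hM n hnN).2
  -- The section `𝒯` need not contain `1`. But `1` lies in the subgroup `𝒯ᴺ`, so `1 = t'ᴺ`; the same
  -- reasoning gives `t' = t`, whence `g = 1`.
  obtain ⟨t', ht', h1⟩ : (1 : X.G) ∈ powSet X.T N := hH ▸ H.one_mem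
  have ht'0 : (t' : Ort (Fin d₁) × Euc (Fin d₂)).2 0 = 0 := by
    have h2 := hpow N t' ht'
    have h3 : ((t' ^ N : X.G) : Ort (Fin d₁) × Euc (Fin d₂)).2 0 = 0 := by
      have h4 : t' ^ N = 1 := h1
      rw [h4]
      rfl
    rw [h3] at h2
    rw [← Nat.cast_smul_eq_nsmul ℝ] at h2
    exact (smul_eq_zero.1 h2.symm).resolve_left (Nat.cast_ne_zero.2 hNpos.ne')
  rw [honly t' ht' ht'0] at h1
  exact hg (htg.symm.trans h1)

theorem Property2.exists_ne_one (hX : Nontrivial X.G) (hR : X.Property2 (R : Set X.G)) :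
    ∃ r ∈ R, r ≠ 1 := by
  obtain ⟨-, R', R'', h1, hgen, ⟨-, h1', -⟩, hmul⟩ := hR
  by_contra! hcon
  have hsub : R' ⊆ {1} := fun r hr => hcon r (by simpa using hmul r hr 1 h1')
  have h := Subgroup.closure_mono hsub
  rw [hgen, Subgroup.closure_singleton_one] at h
  exact top_ne_bot (le_bot_iff.1 h)

/-- Take `u` supported on one coset `r𝒯ᴺ` with `r ∈ R` outside `𝒯ᴺ`, and with `rot(r) u(r) = z = r ·
x₀ - x₀`. If `u` were rigid on `R`, then `u(1) = 0` would give `a = 0` and `z = S z`; skewness then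
forces `z = 0`, against injectivity of the orbit map. -/
theorem exists_seminormR_pos (hX : Nontrivial X.G) (hC : X.IsRepSystem C)
    (hR : X.Property2 (R : Set X.G)) : ∃ u : X.Uper, 0 < X.seminormR C R u := by
  classical
  obtain ⟨r, hr, hr1⟩ := hR.exists_ne_one hX
  have h1R := RigidApprox.one_mem hR
  obtain ⟨N, hN, hrN⟩ := exists_notMem_powSet hr1
  obtain ⟨H, hn, hH⟩ := hN.2
  rw [← hH, SetLike.mem_coe] at hrN
  set z := X.act r X.x₀ - X.x₀ with hz
  have hz0 : z ≠ 0 := by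
    intro h
    refine hr1 (X.injective ?_)
    change X.act r X.x₀ = X.act 1 X.x₀
    rw [act_one]
    exact sub_eq_zero.1 h
  set f : X.G → Amb d₁ d₂ := fun h => if r⁻¹ * h ∈ H then X.lin r⁻¹ z else 0 with hf
  have hper : X.IsPeriodicWith N f := by
    intro g t ht
    rw [← hH] at ht
    simp only [hf]
    rw [← mul_assoc, H.mul_mem_cancel_right ht]
  let u : X.Uper := ⟨⟨f, memℓp_infty ⟨‖X.lin r⁻¹ z‖, by
    rintro _ ⟨g, rfl⟩
    simp only [hf]
    split_ifs
    · exact le_rfl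
    · simp⟩⟩, N, hN, hper⟩
  have hval : X.val u = f := rfl
  refine ⟨u, lt_of_le_of_ne (Real.sqrt_nonneg _) fun h0 => ?_⟩
  rw [seminormR, seminorm_eq hC _ hN (hval ▸ hper)] at h0
  have hdist : X.isoDist (skew d₁ d₂) R u 1 = 0 := by
    have hnn : 0 ≤ X.avg C N fun g => X.isoDist (skew d₁ d₂) R u g ^ 2 := by
      rw [hC.avg_eq_sum hN]
      positivity
    have h1 := (Real.sqrt_eq_zero hnn).1 h0.symm
    rw [hC.avg_eq_sum hN, div_eq_zero_iff, or_iff_left (hC.ncard_pos hN).ne',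
      Finset.sum_eq_zero_iff_of_nonneg fun g _ => sq_nonneg _] at h1
    -- `1` need not be a representative, so periodicity carries the vanishing from the
    -- representative of its coset.
    obtain ⟨c, ⟨hc, hc1⟩, -⟩ := hC N hN 1
    have h2 := h1 c ((hC.finite hN).mem_toFinset.2 hc)
    have h3 := isoDist_periodic (R := R) (skew d₁ d₂) hN (u := u) (hval ▸ hper) c _ hc1
    rw [mul_inv_cancel_left] at h3
    rw [← h3]
    exact pow_eq_zero_iff two_ne_zero |>.1 h2
  have hmem : (WithLp.toLp 2 fun h : R => X.val u (1 * h) : X.FunR R) ∈ X.Uiso (skew d₁ d₂) R := by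
    rw [← Submodule.starProjection_eq_self_iff]
    have h := norm_eq_zero.1 hdist
    rw [Submodule.starProjection_orthogonal] at h
    exact (sub_eq_zero.1 h).symm
  obtain ⟨w, ⟨a, ha⟩, w', ⟨S, hS, hw'⟩, hww⟩ := Submodule.mem_sup.1 hmem
  have heq : ∀ h : R, X.lin h (f h) = a + Matrix.toEuclideanLin S (X.act h X.x₀ - X.x₀) := by
    intro h
    have h1 : f h = w h + w' h := by
      rw [← PiLp.add_apply, hww]
      simp [hval]
    rw [h1, map_add, ha, hw']
  have hf1 : f 1 = 0 := by
    have : r⁻¹ * 1 ∉ H := by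
      rw [mul_one]
      exact fun h => hrN (inv_mem_iff.1 h)
    simp only [hf, if_neg this]
  have hfr : f r = X.lin r⁻¹ z := by
    have : r⁻¹ * r ∈ H := by
      rw [inv_mul_cancel]
      exact H.one_mem
    simp only [hf, if_pos this]
  have ha0 : a = 0 := by
    have := heq ⟨1, h1R⟩
    simpa [hf1] using this.symm
  have hzS : z = Matrix.toEuclideanLin S z := by
    have := heq ⟨r, hr⟩
    rwa [hfr, ← lin_mul, mul_inv_cancel, lin_one, ha0, zero_add] at this
  have h := inner_toEuclideanLin_self_of_skew hS z
  rw [← hzS, inner_self_eq_zero] at h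
  exact hz0 h

/-- The set contains `-K` and is bounded above by the quotient `q u₀ / p u₀ ^ 2`. -/
theorem exists_real_eq_sSup {U : Type} {p q : U → ℝ} {K : ℝ}
    (hlow : ∀ u, -K * p u ^ 2 ≤ q u) {u₀ : U} (hu₀ : 0 < p u₀) :
    ∃ r : ℝ, sSup ((fun c : ℝ => (c : EReal)) '' {c | ∀ u, c * p u ^ 2 ≤ q u}) = r := by
  set Q := sSup ((fun c : ℝ => (c : EReal)) '' {c | ∀ u, c * p u ^ 2 ≤ q u}) with hQ
  have hbot : ((-K : ℝ) : EReal) ≤ Q := le_sSup ⟨-K, hlow, rfl⟩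
  have htop : Q ≤ ((q u₀ / p u₀ ^ 2 : ℝ) : EReal) := by
    refine sSup_le ?_
    rintro _ ⟨c, hc, rfl⟩
    exact EReal.coe_le_coe_iff.2 ((le_div_iff₀ (by positivity)).2 (hc u₀))
  refine ⟨Q.toReal, (EReal.coe_toReal ?_ ?_).symm⟩
  · exact fun h => by simp [h] at htop
  · exact fun h => by simp [h] at hbot

end ObjectiveStructure

end ObjStr

theorem mainTheorem4 {d₁ d₂ : ℕ} (X : ObjStr.ObjectiveStructure d₁ d₂) (hX : Nontrivial X.G)
    (C : ℕ → Set X.G) (hC : X.IsRepSystem C)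
    (R : Finset X.G) (hR : X.Property2 (R : Set X.G))
    (V : (X.Off → ObjStr.Amb d₁ d₂) → ℝ) (hV : X.IsFiniteRangePotential V)
    (hy₀ : X.siteDeriv V = 0) :
    ContDiff ℝ 2 (X.energy C V) ∧
      (∃ K : ℝ, 0 < K ∧ ∀ u v : X.Uper,
        |X.hessian C V u v| ≤ K * X.seminormR C R u * X.seminormR C R v) ∧
      (∃ r : ℝ, X.lambdaA C V R = r) ∧
      (∃ r : ℝ, X.lambdaAZeroZero C V R = r) := by
  open ObjStr ObjectiveStructure in
  obtain ⟨RV, v, hv, hVv, hrot, hcrit⟩ := hV.exists_finite_dimensional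
  obtain ⟨hsmooth, hhess⟩ := energy_contDiff_and_hessian hC hV.rotation RV hv hVv
  have hb : ∀ S ∈ skew d₁ d₂, fderiv ℝ (fderiv ℝ v) (fun h => X.y₀ h)
      (fun h => Matrix.toEuclideanLin S (X.y₀ h)) = 0 := fun S hS =>
    fderiv_fderiv_apply_skewAdjoint hv hrot (hcrit hy₀) (toEuclideanCLM_mem_skewAdjoint hS)
  have hsymm : IsSymmSndFDerivAt ℝ v (fun h => X.y₀ h) :=
    hv.contDiffAt.isSymmSndFDerivAt (by simp)
  obtain ⟨K, hK, hbound⟩ := hessian_bound hC hR RV _ hb fun S hS z => by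
    rw [hsymm.eq, hb S hS]
    rfl
  have hmain : ∀ u u' : X.Uper,
      |X.hessian C V u u'| ≤ K * X.seminormR C R u * X.seminormR C R u' := by
    intro u u'
    obtain ⟨hN, hu⟩ := X.period_spec u
    obtain ⟨hN', hu'⟩ := X.period_spec u'
    obtain ⟨P, hP, h, h'⟩ := exists_common_period hN hN'
    have h1 := hu.of_dvd X hN h
    have h2 := hu'.of_dvd X hN' h'
    rw [hhess u u' P hP h1 h2]
    exact hbound u u' P hP h1 h2
  have hlow : ∀ u : X.Uper, -K * X.seminormR C R u ^ 2 ≤ X.hessian C V u u := by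
    intro u
    have := neg_le_of_abs_le (hmain u u)
    linarith
  -- Fewer skew matrices mean a smaller `U_iso` and a larger seminorm. So `-K` stays admissible,
  -- being negative, and `u₀` keeps a positive seminorm.
  have hle : ∀ u : X.Uper, X.seminormR C R u ≤ X.seminormRZeroZero C R u :=
    seminorm_antitone hC fun S hS => hS.1
  obtain ⟨u₀, hu₀⟩ := exists_seminormR_pos hX hC hR
  refine ⟨hsmooth, ⟨K, hK, hmain⟩, exists_real_eq_sSup hlow hu₀,
    exists_real_eq_sSup (K := K) (fun u => le_trans ?_ (hlow u)) (hu₀.trans_le (hle u₀))⟩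
  have : X.seminormR C R u ^ 2 ≤ X.seminormRZeroZero C R u ^ 2 :=
    pow_le_pow_left₀ (Real.sqrt_nonneg _) (hle u) 2
  have := mul_le_mul_of_nonneg_left this hK.le
  linarith
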